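/- Let $A=(0,1)\times S^1$ be the open annulus, where $S^1=\{z\in\mathbb C:|z|=1\}$, let $d$ be an integer with $|d|>1$, and let $m_d(z)=z^d$ on $S^1$. Let $f:A\to A$ be a covering map of degree $d$, i.e. $f$ induces multiplication by $d$ on $H_1(A,\mathbb Z)\cong\mathbb Z$. A semiconjugacy between $f$ and $m_d$ is a continuous map $h:A\to S^1$ with $h\circ f=m_d\circ h$ for which $h_*:H_1(A,\mathbb Z)\to H_1(S^1,\mathbb Z)$ is an isomorphism. An open set $U\subset A$ is essential if the inclusion induces a surjection $H_1(U,\mathbb Z)\to H_1(A,\mathbb Z)$; a subset of $A$ is essential if all its open neighbourhoods in $A$ are essential. A connector is a connected, closed subset $C$ of $A$ such that for every $r>0$ there are points $(x,y),(x',y')\in C$ with $x<r$ and $x'>1-r$. A connector is trivial if it is not essential, and $C$ is invariant if $f(C)=C$. 1. If $h$ is a semiconjugacy between $f$ and $m_d$, then for every $z\in S^1$ the fibre $h^{-1}(z)$ contains a connector. 2. If moreover $d>1$, then there is an invariant trivial connector contained in $h^{-1}(1)$. 3. There exists a semiconjugacy between $f$ and $m_d$ if and only if $f$ has an invariant trivial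 connector. -/

import Mathlib

open Set

/-- The open annulus `A = (0,1) × S¹`, with `S¹` the unit circle of `ℂ`. -/
abbrev OpenAnnulus : Type := Set.Ioo (0 : ℝ) 1 × Circle

/-- `LoopClass γ n`: the loop `γ` in the circle has winding number `n`, i.e. `γ` lifts along
`θ ↦ exp(iθ)` to a path in `ℝ` whose end point minus its starting point is `2πn`.
Every loop has exactly one such `n`, which is its class under `H₁(S¹, ℤ) = ℤ`. -/
def LoopClass {z : Circle} (γ : Path z z) (n : ℤ) : Prop :=
  ∃ θ : C(unitInterval, ℝ), (∀ t, Circle.exp (θ t) = γ t) ∧ θ 1 - θ 0 = 2 * Real.pi * n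

/-- `AnnulusLoopClass γ n`: the class of the loop `γ` under `H₁(A, ℤ) = ℤ` is `n`; the
identification is induced by the homotopy equivalence `A → S¹`, `(x, z) ↦ z`. -/
def AnnulusLoopClass {a : OpenAnnulus} (γ : Path a a) (n : ℤ) : Prop :=
  LoopClass (γ.map continuous_snd) n

/-- `f` has degree `d`: the map `f_*` induced on `H₁(A, ℤ) = ℤ`, `[γ] ↦ [f ∘ γ]`, is
`n ↦ d * n`. -/
def HasDegree (f : C(OpenAnnulus, OpenAnnulus)) (d : ℤ) : Prop :=
  ∀ (a : OpenAnnulus) (γ : Path a a) (n : ℤ),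
    AnnulusLoopClass γ n → AnnulusLoopClass (γ.map f.continuous) (d * n)

/-- The map `h_* : H₁(A, ℤ) = ℤ → H₁(S¹, ℤ) = ℤ`, `[γ] ↦ [h ∘ γ]`, is an isomorphism. -/
def InducesIso (h : C(OpenAnnulus, Circle)) : Prop :=
  ∃ e : ℤ ≃+ ℤ, ∀ (a : OpenAnnulus) (γ : Path a a) (n : ℤ),
    AnnulusLoopClass γ n → LoopClass (γ.map h.continuous) (e n)

/-- `h` is a semiconjugacy between `f` and `m_d(z) = z ^ d` on the circle. -/
structure IsSemiconjugacy (f : C(OpenAnnulus, OpenAnnulus)) (d : ℤ)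
    (h : C(OpenAnnulus, Circle)) : Prop where
  semiconj : Function.Semiconj h f (fun z : Circle => z ^ d)
  inducesIso : InducesIso h

/-- For an open set `U`: the map `H₁(U, ℤ) → H₁(A, ℤ) = ℤ` induced by the inclusion is onto.
Its image is the subgroup generated by the classes of the loops contained in `U`. -/
def IsEssentialOpen (U : Set OpenAnnulus) : Prop :=
  AddSubgroup.closure {n : ℤ | ∃ (a : OpenAnnulus) (γ : Path a a),
    (∀ t, γ t ∈ U) ∧ AnnulusLoopClass γ n} = ⊤

/-- A subset of the annulus is essential if every open neighbourhood of it is essential. -/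
def IsEssential (X : Set OpenAnnulus) : Prop :=
  ∀ U : Set OpenAnnulus, IsOpen U → X ⊆ U → IsEssentialOpen U

/-- A connector: a connected closed subset of the annulus that accumulates at both boundary
components. -/
structure IsConnector (C : Set OpenAnnulus) : Prop where
  isConnected : IsConnected C
  isClosed : IsClosed C
  accumulates : ∀ r : ℝ, 0 < r →
    (∃ p ∈ C, (p.1 : ℝ) < r) ∧ (∃ q ∈ C, 1 - r < (q.1 : ℝ))

/-- A trivial connector: a connector that is not essential. -/
structure IsTrivialConnector (C : Set OpenAnnulus) : Prop where
  isConnector : IsConnector C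
  not_essential : ¬ IsEssential C

/-! Everything takes place on the strip (0,1) × ℝ, the universal cover of the annulus. A covering of
degree d lifts to a homeomorphism F of the strip with F(p + n) = F(p) + dn (vertical translations),
and a semiconjugacy amounts to a height H with H(p + n) = H(p) + n and H ∘ F = dH, up to a sign and
a deck translation (`IsSemiconjugacy.exists_lift`, `exists_descend`). Trivial connectors correspond
to cuts (`IsCut`).

From heights to connectors: let W be the part of {H > c} joined to the upper end, and Q the
component of its complement that contains the lower end. The frontier of Q lies in {H = c}, and it
is connected because the strip is unicoherent (`IsPreconnected.inter_of_union_eq_univ`). Its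
projection is a connector (`exists_isCut_subset_level`). If d > 0 and c = 0, then F preserves W and
Q, so the connector is invariant.

From connectors to heights: an invariant trivial connector lifts to a cut M that a suitable lift F
maps into itself (`IsTrivialConnector.exists_isCut`). The number φ(p) of the translate of M just
above p satisfies φ ∘ F = dφ + O(1), so φ(Fᵏp)/dᵏ converges to a height (`IsCut.exists_expanding`).
That a cut separates the ends (`IsCut.disjoint_side`) and that loops in a nonessential open set have
class zero both rest on the crossing of paths (`exists_path_crossing`).

Negative d: F reverses the sign of H, so the frontier of Q need not be invariant. The limit
construction, applied to a cut in {H = 0}, gives a new height for which the sets above and below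
level zero are connected. The complement of each has a component containing the other set; F
exchanges these two components, and their intersection is connected by unicoherence
(`exists_isCut_image_eq`). -/

/-! ### The circle as ℝ/ℤ and lifting to ℝ -/

/-- The parametrisation `t ↦ exp(2πit)` of the circle, of period `1`. -/
noncomputable def turn (t : ℝ) : Circle := Circle.exp (2 * Real.pi * t)

theorem continuous_turn : Continuous turn :=
  Circle.exp.continuous.comp (continuous_const.mul continuous_id)

@[simp] theorem turn_zero : turn 0 = 1 := by simp [turn]

theorem turn_eq_turn {s t : ℝ} : turn s = turn t ↔ ∃ n : ℤ, s = t + n := by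
  have hp : (2 * Real.pi) ≠ 0 := by positivity
  rw [turn, turn, Circle.exp_eq_exp]
  constructor
  · rintro ⟨n, hn⟩
    refine ⟨n, mul_left_cancel₀ hp ?_⟩
    linear_combination hn
  · rintro ⟨n, rfl⟩
    exact ⟨n, by ring⟩

theorem turn_add_int (t : ℝ) (n : ℤ) : turn (t + n) = turn t :=
  turn_eq_turn.2 ⟨n, rfl⟩

theorem turn_zsmul (n : ℤ) (t : ℝ) : turn (n * t) = turn t ^ n := by
  have h : 2 * Real.pi * (n * t) = n • (2 * Real.pi * t) := by rw [zsmul_eq_mul]; ring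
  rw [turn, turn, h]
  exact map_zsmul Circle.expHom n (2 * Real.pi * t)

theorem isCoveringMap_turn : IsCoveringMap turn := by
  have hp : (2 * Real.pi) ≠ 0 := by positivity
  exact Circle.isCoveringMap_exp.comp_homeomorph (Homeomorph.mulLeft₀ _ hp)

theorem turn_surjective : Function.Surjective turn := by
  intro z
  refine ⟨Complex.arg z / (2 * Real.pi), ?_⟩
  rw [turn, mul_div_cancel₀ _ (by positivity), Circle.exp_arg]

theorem exists_turn_lift {X : Type*} [TopologicalSpace X] [SimplyConnectedSpace X]
    [LocallyPathConnectedSpace X] (g : C(X, Circle)) :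
    ∃ θ : C(X, ℝ), ∀ x, turn (θ x) = g x := by
  obtain ⟨x₀⟩ : Nonempty X := inferInstance
  obtain ⟨t₀, ht₀⟩ := turn_surjective (g x₀)
  obtain ⟨θ, ⟨-, h⟩, -⟩ := isCoveringMap_turn.existsUnique_continuousMap_lifts g x₀ t₀ ht₀
  exact ⟨θ, congr_fun h⟩

/-- A continuous function on a connected set with values close to integers is close to one
integer. -/
theorem IsPreconnected.exists_int_forall_abs_sub_le {X : Type*} [TopologicalSpace X] {S : Set X}
    (hS : IsPreconnected S) {ψ : X → ℝ} (hψ : ContinuousOn ψ S) {c : ℝ} (hc : c < 1 / 2)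
    (h : ∀ x ∈ S, ∃ n : ℤ, |ψ x - n| ≤ c) : ∃ n : ℤ, ∀ x ∈ S, |ψ x - n| ≤ c := by
  rcases S.eq_empty_or_nonempty with rfl | ⟨x₀, hx₀⟩
  · exact ⟨0, by simp⟩
  obtain ⟨n, hn⟩ := h x₀ hx₀
  refine ⟨n, fun x hx => ?_⟩
  have key : ∀ m : ℤ, (m : ℝ) + 1 / 2 ∉ ψ '' S := by
    rintro m ⟨y, hy, hym⟩
    obtain ⟨k, hk⟩ := h y hy
    rw [hym, abs_le] at hk
    have h1 : (m : ℝ) - k < 0 := by linarith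
    have h2 : (-1 : ℝ) < m - k := by linarith
    have h3 : m - k < 0 := by exact_mod_cast h1
    have h4 : -1 < m - k := by exact_mod_cast h2
    omega
  have hI := hS.intermediate_value hx₀ hx hψ
  have hI' := hS.intermediate_value hx hx₀ hψ
  obtain ⟨k, hk⟩ := h x hx
  rw [abs_le] at hn hk
  have hkn : k = n := by
    rcases lt_trichotomy k n with hlt | heq | hgt
    · exfalso
      have : (k : ℝ) + 1 ≤ n := by exact_mod_cast hlt
      exact key k (hI' ⟨by linarith, by linarith⟩)
    · exact heq
    · exfalso
      have : (n : ℝ) + 1 ≤ k := by exact_mod_cast hgt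
      exact key n (hI ⟨by linarith, by linarith⟩)
  rw [abs_le, ← hkn]
  exact hk

/-! ### Unicoherence and crossing paths -/

/-- Unicoherence of simply connected spaces. -/
theorem IsPreconnected.inter_of_union_eq_univ {X : Type*} [TopologicalSpace X]
    [SimplyConnectedSpace X] [LocallyPathConnectedSpace X] [NormalSpace X] {A B : Set X}
    (hA : IsPreconnected A) (hB : IsPreconnected B) (hAc : IsClosed A) (hBc : IsClosed B)
    (hAB : A ∪ B = univ) : IsPreconnected (A ∩ B) := by
  rw [isPreconnected_closed_iff]
  intro t t' ht ht' hsub ⟨p, hp, hpt⟩ ⟨q, hq, hqt⟩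
  by_contra hne
  rw [not_nonempty_iff_eq_empty] at hne
  have hdisj : Disjoint (A ∩ B ∩ t) (A ∩ B ∩ t') := by
    rw [disjoint_iff_inter_eq_empty, ← hne]; ext; simp; tauto
  obtain ⟨f, hf0, hf1, -⟩ := exists_continuous_zero_one_of_isClosed
    ((hAc.inter hBc).inter ht) ((hAc.inter hBc).inter ht') hdisj
  -- The maps `turn (f / 2)` on `A` and `turn (-f / 2)` on `B` agree on `A ∩ B`, where `f` is 0 or
  -- 1. For a lift `θ` of the glued map, `θ - f / 2` is constant on `A` and `θ + f / 2` on `B`; the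
  -- two constants are equal by the values at `p` and differ by 1 by those at `q`.
  have hfr : ∀ a ∈ frontier {x | x ∈ A}, turn (f a / 2) = turn (-(f a / 2)) := by
    intro a ha
    have haA : a ∈ A := hAc.frontier_subset ha
    have haB : a ∈ B := by
      rw [frontier_eq_closure_inter_closure] at ha
      refine closure_minimal ?_ hBc ha.2
      intro y hy
      have : y ∈ A ∪ B := hAB ▸ mem_univ y
      exact this.resolve_left hy
    rcases hsub ⟨haA, haB⟩ with h | h
    · simp [hf0 ⟨⟨haA, haB⟩, h⟩]
    · rw [hf1 ⟨⟨haA, haB⟩, h⟩]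
      exact turn_eq_turn.2 ⟨1, by norm_num⟩
  classical
  let g : C(X, Circle) := ⟨fun x => if x ∈ A then turn (f x / 2) else turn (-(f x / 2)),
    Continuous.if hfr (continuous_turn.comp (f.continuous.div_const 2))
      (continuous_turn.comp (f.continuous.div_const 2).neg)⟩
  obtain ⟨θ, hθ⟩ := exists_turn_lift g
  have hgB : ∀ x ∈ B, g x = turn (-(f x / 2)) := by
    intro x hx
    by_cases hxA : x ∈ A
    · refine (if_pos hxA).trans ?_
      rcases hsub ⟨hxA, hx⟩ with h | h
      · simp [hf0 ⟨⟨hxA, hx⟩, h⟩]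
      · rw [hf1 ⟨⟨hxA, hx⟩, h⟩]
        exact turn_eq_turn.2 ⟨1, by norm_num⟩
    · exact if_neg hxA
  obtain ⟨a, ha⟩ := hA.exists_int_forall_abs_sub_le (ψ := fun x => θ x - f x / 2) (c := 0)
    (by fun_prop) (by norm_num) (fun x hx => by
      obtain ⟨n, hn⟩ := turn_eq_turn.1 ((hθ x).trans (if_pos hx))
      exact ⟨n, by simp [hn]⟩)
  obtain ⟨b, hb⟩ := hB.exists_int_forall_abs_sub_le (ψ := fun x => θ x + f x / 2) (c := 0)
    (by fun_prop) (by norm_num) (fun x hx => by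
      obtain ⟨n, hn⟩ := turn_eq_turn.1 ((hθ x).trans (hgB x hx))
      exact ⟨n, by simp [hn]⟩)
  have hp0 : f p = 0 := hf0 ⟨hp, hpt⟩
  have hq1 : f q = 1 := hf1 ⟨hq, hqt⟩
  have h1 := sub_eq_zero.1 (abs_nonpos_iff.1 (ha p hp.1))
  have h2 := sub_eq_zero.1 (abs_nonpos_iff.1 (hb p hp.2))
  have h3 := sub_eq_zero.1 (abs_nonpos_iff.1 (ha q hq.1))
  have h4 := sub_eq_zero.1 (abs_nonpos_iff.1 (hb q hq.2))
  rw [hp0] at h1 h2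
  rw [hq1] at h3 h4
  linarith

theorem exists_int_abs_sub_le_of_cos_nonneg {x : ℝ} (h : 0 ≤ Real.cos (2 * Real.pi * x)) :
    ∃ n : ℤ, |x - n| ≤ 1 / 4 := by
  refine ⟨round x, ?_⟩
  by_contra! hlt
  have hle := abs_sub_round x
  have hcos : Real.cos (2 * Real.pi * x) = Real.cos (2 * Real.pi * |x - round x|) := by
    rw [← abs_of_pos Real.two_pi_pos, ← abs_mul, Real.cos_abs, abs_of_pos Real.two_pi_pos,
      mul_sub, mul_comm (2 * Real.pi) (round x : ℝ), Real.cos_sub_int_mul_two_pi]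
  rw [hcos] at h
  have := Real.pi_pos
  refine absurd h (not_le.2 (Real.cos_neg_of_pi_div_two_lt_of_lt ?_ ?_)) <;> nlinarith

/-- The Poincaré–Miranda theorem in dimension two. -/
theorem exists_eq_zero_of_sign_on_boundary {u v : ℝ × ℝ → ℝ} (hu : Continuous u)
    (hv : Continuous v)
    (hu0 : ∀ s ∈ Icc (0 : ℝ) 1, u (0, s) ≤ 0) (hu1 : ∀ s ∈ Icc (0 : ℝ) 1, 0 ≤ u (1, s))
    (hv0 : ∀ s ∈ Icc (0 : ℝ) 1, v (s, 0) ≤ 0) (hv1 : ∀ s ∈ Icc (0 : ℝ) 1, 0 ≤ v (s, 1)) :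
    ∃ z, u z = 0 ∧ v z = 0 := by
  by_contra! hne
  let w : ℝ × ℝ → ℂ := fun z => ⟨u z, v z⟩
  have hw : Continuous w := by
    have : w = fun z => (u z : ℂ) + v z * Complex.I := by
      ext z; exact Complex.mk_eq_add_mul_I _ _
    rw [this]; fun_prop
  have hw0 : ∀ z, w z ≠ 0 := fun z hz =>
    hne z (congrArg Complex.re hz) (congrArg Complex.im hz)
  -- Without a zero, the direction of (u, v) has a continuous angle `θ`, counted in turns, on the
  -- whole plane. The sign condition on each side of the square confines it to a half turn centred
  -- at 0, 1/4, 1/2, 3/4 for the right, top, left and bottom side, up to an integer. Common corners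
  -- force these integers to agree.
  let g : C(ℝ × ℝ, Circle) := ⟨fun z => ⟨w z / ‖w z‖, by
      have := norm_ne_zero_iff.2 (hw0 z)
      simp [Submonoid.unitSphere, this]⟩, by
    refine Continuous.subtype_mk (hw.div (by fun_prop) fun z => ?_) _
    simpa using hw0 z⟩
  obtain ⟨θ, hθ⟩ := exists_turn_lift g
  have hr : ∀ z, 0 < ‖w z‖ := fun z => norm_pos_iff.2 (hw0 z)
  have hcs : ∀ z, Complex.exp ((2 * Real.pi * θ z : ℝ) * Complex.I) = w z / ‖w z‖ := fun z => by
    have := congrArg (Subtype.val) (hθ z)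
    rw [← Circle.coe_exp]
    exact this
  have hcos : ∀ z, Real.cos (2 * Real.pi * θ z) = u z / ‖w z‖ := fun z => by
    have := congrArg Complex.re (hcs z)
    rwa [Complex.exp_ofReal_mul_I_re, Complex.div_ofReal_re] at this
  have hsin : ∀ z, Real.sin (2 * Real.pi * θ z) = v z / ‖w z‖ := fun z => by
    have := congrArg Complex.im (hcs z)
    rwa [Complex.exp_ofReal_mul_I_im, Complex.div_ofReal_im] at this
  have hcos' : ∀ z, Real.cos (2 * Real.pi * (θ z - 1 / 2)) = - (u z / ‖w z‖) := fun z => by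
    rw [← hcos, ← Real.cos_sub_pi]; congr 1; ring
  have hsin' : ∀ z, Real.cos (2 * Real.pi * (θ z - 1 / 4)) = v z / ‖w z‖ := fun z => by
    rw [← hsin, ← Real.cos_sub_pi_div_two]; congr 1; ring
  have hsin'' : ∀ z, Real.cos (2 * Real.pi * (θ z - 3 / 4)) = - (v z / ‖w z‖) := fun z => by
    rw [← hsin, ← Real.cos_sub_pi_div_two, ← Real.cos_sub_pi]; congr 1; ring
  have key : ∀ (e : ℝ → ℝ × ℝ) (α : ℝ), Continuous e →
      (∀ s ∈ Icc (0 : ℝ) 1, 0 ≤ Real.cos (2 * Real.pi * (θ (e s) - α))) →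
      ∃ n : ℤ, ∀ s ∈ Icc (0 : ℝ) 1, |θ (e s) - α - n| ≤ 1 / 4 := fun e α he h =>
    isPreconnected_Icc.exists_int_forall_abs_sub_le (ψ := fun s => θ (e s) - α)
      (by fun_prop) (by norm_num) (fun s hs => exists_int_abs_sub_le_of_cos_nonneg (h s hs))
  obtain ⟨a, ha⟩ := key (fun s => (1, s)) 0 (by fun_prop) (fun s hs => by
    rw [sub_zero, hcos]; exact div_nonneg (hu1 s hs) (hr _).le)
  obtain ⟨b, hb⟩ := key (fun s => (s, 1)) (1 / 4) (by fun_prop) (fun s hs => by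
    rw [hsin']; exact div_nonneg (hv1 s hs) (hr _).le)
  obtain ⟨c, hc⟩ := key (fun s => (0, s)) (1 / 2) (by fun_prop) (fun s hs => by
    rw [hcos', ← neg_div]; exact div_nonneg (neg_nonneg.2 (hu0 s hs)) (hr _).le)
  obtain ⟨d, hd⟩ := key (fun s => (s, 0)) (3 / 4) (by fun_prop) (fun s hs => by
    rw [hsin'', ← neg_div]; exact div_nonneg (neg_nonneg.2 (hv0 s hs)) (hr _).le)
  have I0 : (0 : ℝ) ∈ Icc (0 : ℝ) 1 := by simp
  have I1 : (1 : ℝ) ∈ Icc (0 : ℝ) 1 := by simp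
  have h1 := abs_le.1 (ha 1 I1)
  have h2 := abs_le.1 (hb 1 I1)
  have h3 := abs_le.1 (hb 0 I0)
  have h4 := abs_le.1 (hc 1 I1)
  have h5 := abs_le.1 (hc 0 I0)
  have h6 := abs_le.1 (hd 0 I0)
  have h7 := abs_le.1 (hd 1 I1)
  have h8 := abs_le.1 (ha 0 I0)
  have e1 : a = b := by
    have l : (a : ℝ) - b < 1 := by linarith
    have r : (-1 : ℝ) < a - b := by linarith
    have l' : a - b < 1 := by exact_mod_cast l
    have r' : -1 < a - b := by exact_mod_cast r
    omega
  have e2 : b = c := by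
    have l : (b : ℝ) - c < 1 := by linarith
    have r : (-1 : ℝ) < b - c := by linarith
    have l' : b - c < 1 := by exact_mod_cast l
    have r' : -1 < b - c := by exact_mod_cast r
    omega
  have e3 : c = d := by
    have l : (c : ℝ) - d < 1 := by linarith
    have r : (-1 : ℝ) < c - d := by linarith
    have l' : c - d < 1 := by exact_mod_cast l
    have r' : -1 < c - d := by exact_mod_cast r
    omega
  -- At the corner (1, 0) the bottom side gives `θ - a ≥ 1/2` and the right side `θ - a ≤ 1/4`.
  subst e1 e2 e3
  linarith

/-- Two paths, one crossing from left to right and the other from top to bottom, meet. -/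
theorem exists_path_crossing {Y : Type*} [TopologicalSpace Y] {x y : Y → ℝ} (hx : Continuous x)
    (hy : Continuous y) {a b p q : Y} (η : Path a b) (δ : Path p q)
    (hl : ∀ s, x a ≤ x (δ s)) (hr : ∀ s, x (δ s) ≤ x b)
    (ht : ∀ s, y (η s) ≤ y p) (hb : ∀ s, y q ≤ y (η s)) :
    ∃ s t, x (η s) = x (δ t) ∧ y (η s) = y (δ t) := by
  obtain ⟨z, hz1, hz2⟩ := exists_eq_zero_of_sign_on_boundary
    (u := fun z => x (η.extend z.1) - x (δ.extend z.2))
    (v := fun z => y (η.extend z.1) - y (δ.extend z.2))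
    (by fun_prop) (by fun_prop)
    (fun s hs => by
      simp only [Path.extend_zero, Path.extend_apply _ hs]
      linarith [hl ⟨s, hs⟩])
    (fun s hs => by
      simp only [Path.extend_one, Path.extend_apply _ hs]
      linarith [hr ⟨s, hs⟩])
    (fun s hs => by
      simp only [Path.extend_zero, Path.extend_apply _ hs]
      linarith [ht ⟨s, hs⟩])
    (fun s hs => by
      simp only [Path.extend_one, Path.extend_apply _ hs]
      linarith [hb ⟨s, hs⟩])
  exact ⟨projIcc 0 1 zero_le_one z.1, projIcc 0 1 zero_le_one z.2, sub_eq_zero.1 hz1,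
    sub_eq_zero.1 hz2⟩

/-! ### Components of complements and their frontiers -/

section Components

variable {X : Type*} [TopologicalSpace X]

theorem IsClosed.isClosed_connectedComponentIn {F : Set X} (hF : IsClosed F) (x : X) :
    IsClosed (connectedComponentIn F x) := by
  by_cases hx : x ∈ F
  · refine isClosed_of_closure_subset
      (isPreconnected_connectedComponentIn.closure.subset_connectedComponentIn
        (subset_closure (mem_connectedComponentIn hx)) ?_)
    exact closure_minimal (connectedComponentIn_subset F x) hF
  · rw [connectedComponentIn_eq_empty hx]; exact isClosed_empty

theorem connectedComponentIn_disjoint {F : Set X} {x y : X}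
    (h : x ∉ connectedComponentIn F y) :
    Disjoint (connectedComponentIn F x) (connectedComponentIn F y) := by
  rw [Set.disjoint_left]
  intro z hz hz'
  have hx : x ∈ F := connectedComponentIn_nonempty_iff.1 ⟨z, hz⟩
  refine h ?_
  rw [connectedComponentIn_eq hz', ← connectedComponentIn_eq hz]
  exact mem_connectedComponentIn hx

theorem IsPreconnected.union_of_inter_closure_nonempty {A B : Set X} (hA : IsPreconnected A)
    (hB : IsPreconnected B) (h : (A ∩ closure B).Nonempty) : IsPreconnected (A ∪ B) := by
  obtain ⟨y, hyA, hyB⟩ := h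
  have h1 : IsPreconnected (insert y B) :=
    hB.subset_closure (subset_insert _ _) (insert_subset hyB subset_closure)
  have h2 := IsPreconnected.union y hyA (mem_insert y B) hA h1
  rwa [union_insert, insert_eq_of_mem (mem_union_left _ hyA)] at h2

variable [LocallyConnectedSpace X]

theorem subset_interior_connectedComponentIn {F : Set X} (x : X) :
    connectedComponentIn F x ∩ interior F ⊆ interior (connectedComponentIn F x) := by
  rintro z ⟨hz, hzF⟩
  refine mem_interior.2 ⟨connectedComponentIn (interior F) z, ?_,
    isOpen_interior.connectedComponentIn, mem_connectedComponentIn hzF⟩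
  rw [connectedComponentIn_eq hz]
  exact connectedComponentIn_mono z interior_subset

variable [PreconnectedSpace X]

/-- Boundary bumping: a component of the complement of an open set touches that set. -/
theorem isPreconnected_connectedComponentIn_compl_union {W : Set X} (hW : IsPreconnected W)
    (hWo : IsOpen W) (hne : W.Nonempty) (x : X) :
    IsPreconnected (connectedComponentIn Wᶜ x ∪ W) := by
  by_cases hx : x ∈ Wᶜ
  · refine isPreconnected_connectedComponentIn.union_of_inter_closure_nonempty hW ?_
    by_contra hemp
    rw [not_nonempty_iff_eq_empty, ← disjoint_iff_inter_eq_empty] at hemp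
    have hopen : IsOpen (connectedComponentIn Wᶜ x) := by
      rw [← subset_interior_iff_isOpen]
      intro z hz
      refine subset_interior_connectedComponentIn x ⟨hz, ?_⟩
      rw [interior_compl]
      exact hemp.subset_compl_right hz
    have huniv := IsClopen.eq_univ ⟨hWo.isClosed_compl.isClosed_connectedComponentIn x, hopen⟩
      ⟨x, mem_connectedComponentIn hx⟩
    obtain ⟨w, hw⟩ := hne
    exact connectedComponentIn_subset Wᶜ x (huniv ▸ mem_univ w) hw
  · rwa [connectedComponentIn_eq_empty hx, empty_union]

/-- Each remaining component of `Wᶜ` touches `W`, so the set is a union of connected sets containing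
`W`. -/
theorem isPreconnected_compl_connectedComponentIn_compl {W : Set X} (hW : IsPreconnected W)
    (hWo : IsOpen W) (hne : W.Nonempty) (x : X) :
    IsPreconnected (connectedComponentIn Wᶜ x)ᶜ := by
  obtain ⟨w, hw⟩ := hne
  have hWQ : W ⊆ (connectedComponentIn Wᶜ x)ᶜ :=
    subset_compl_comm.1 (connectedComponentIn_subset Wᶜ x)
  refine isPreconnected_of_forall w fun y hy => ?_
  by_cases hyW : y ∈ W
  · exact ⟨W, hWQ, hw, hyW, hW⟩
  · exact ⟨connectedComponentIn Wᶜ y ∪ W,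
      union_subset (connectedComponentIn_disjoint hy).subset_compl_right hWQ, Or.inr hw,
      Or.inl (mem_connectedComponentIn hyW),
      isPreconnected_connectedComponentIn_compl_union hW hWo ⟨w, hw⟩ y⟩

/-- For a point off `W` and off the first component, its own component of `Wᶜ` together with `W` is
connected and misses `W'`, since `W'` lies inside the first component. -/
theorem connectedComponentIn_compl_union_eq_univ {W W' : Set X} (hW : IsPreconnected W)
    (hWo : IsOpen W) (hW' : IsPreconnected W') (hd : Disjoint W W') {p p' : X}
    (hp : p ∈ W) (hp' : p' ∈ W') :
    connectedComponentIn Wᶜ p' ∪ connectedComponentIn W'ᶜ p = univ := by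
  refine eq_univ_of_forall fun x => or_iff_not_imp_left.2 fun hx => ?_
  by_cases hxW : x ∈ W
  · exact hW.subset_connectedComponentIn hp hd.subset_compl_right hxW
  · refine (isPreconnected_connectedComponentIn_compl_union hW hWo ⟨p, hp⟩
      x).subset_connectedComponentIn (Or.inr hp) (union_subset ?_ hd.subset_compl_right)
      (Or.inl (mem_connectedComponentIn hxW))
    refine subset_compl_iff_disjoint_right.2 ((connectedComponentIn_disjoint hx).mono_right ?_)
    exact hW'.subset_connectedComponentIn hp' hd.symm.subset_compl_right

/-- The dual of boundary bumping: a component of the open set `Fᶜ` whose closure missed `F` would be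
clopen. -/
theorem isPreconnected_connectedComponentIn_union_compl {F : Set X} (hF : IsPreconnected F)
    (hFc : IsClosed F) (hne : F.Nonempty) {x : X} (hx : x ∉ F) :
    IsPreconnected (connectedComponentIn Fᶜ x ∪ F) := by
  rw [union_comm]
  refine hF.union_of_inter_closure_nonempty isPreconnected_connectedComponentIn ?_
  by_contra hemp
  rw [not_nonempty_iff_eq_empty, ← disjoint_iff_inter_eq_empty] at hemp
  have hcl : IsClosed (connectedComponentIn Fᶜ x) := by
    refine isClosed_of_closure_subset fun z hz => ?_
    have hzF : z ∈ Fᶜ := hemp.subset_compl_left hz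
    obtain ⟨y, hy, hy'⟩ := mem_closure_iff.1 hz _ hFc.isOpen_compl.connectedComponentIn
      (mem_connectedComponentIn hzF)
    rw [connectedComponentIn_eq hy', ← connectedComponentIn_eq hy]
    exact mem_connectedComponentIn hzF
  have huniv := IsClopen.eq_univ ⟨hcl, hFc.isOpen_compl.connectedComponentIn⟩
      ⟨x, mem_connectedComponentIn hx⟩
  obtain ⟨w, hw⟩ := hne
  exact connectedComponentIn_subset Fᶜ x (huniv ▸ mem_univ w) hw

end Components

section Unicoherent

variable {X : Type*} [TopologicalSpace X] [SimplyConnectedSpace X] [LocallyPathConnectedSpace X]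
  [NormalSpace X]

/-- The component and the closure of its complement are closed, connected and cover the space;
unicoherence applies to their intersection. -/
theorem isPreconnected_frontier_connectedComponentIn_compl {W : Set X} (hW : IsPreconnected W)
    (hWo : IsOpen W) (hne : W.Nonempty) (x : X) :
    IsPreconnected (frontier (connectedComponentIn Wᶜ x)) := by
  have hc := hWo.isClosed_compl.isClosed_connectedComponentIn x
  rw [frontier_eq_closure_inter_closure, hc.closure_eq]
  refine IsPreconnected.inter_of_union_eq_univ isPreconnected_connectedComponentIn
    (isPreconnected_compl_connectedComponentIn_compl hW hWo hne x).closure hc isClosed_closure ?_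
  exact eq_univ_of_forall fun y => or_iff_not_imp_left.2 fun hy => subset_closure hy

theorem isPreconnected_inter_connectedComponentIn_compl {W W' : Set X} (hW : IsPreconnected W)
    (hWo : IsOpen W) (hW' : IsPreconnected W') (hWo' : IsOpen W') (hd : Disjoint W W') {p p' : X}
    (hp : p ∈ W) (hp' : p' ∈ W') :
    IsPreconnected (connectedComponentIn Wᶜ p' ∩ connectedComponentIn W'ᶜ p) :=
  IsPreconnected.inter_of_union_eq_univ isPreconnected_connectedComponentIn
    isPreconnected_connectedComponentIn (hWo.isClosed_compl.isClosed_connectedComponentIn _)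
    (hWo'.isClosed_compl.isClosed_connectedComponentIn _)
    (connectedComponentIn_compl_union_eq_univ hW hWo hW' hd hp hp')

end Unicoherent

/-! ### The strip, its translations and the sides of a set -/

/-- The universal cover of the open annulus. -/
abbrev Strip : Type := Ioo (0 : ℝ) 1 × ℝ

instance : LocallyPathConnectedSpace Strip :=
  (isOpen_Ioo.isOpenEmbedding_subtypeVal.prodMap
    (Topology.IsOpenEmbedding.id (X := ℝ))).locallyPathConnectedSpace

instance : ContractibleSpace (Ioo (0 : ℝ) 1) :=
  (convex_Ioo 0 1).contractibleSpace (nonempty_Ioo.2 one_pos)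

theorem image_val_Icc_unit (a b : Ioo (0 : ℝ) 1) :
    Subtype.val '' Icc a b = Icc (a : ℝ) b := by
  ext x
  constructor
  · rintro ⟨y, ⟨h1, h2⟩, rfl⟩
    exact ⟨h1, h2⟩
  · rintro ⟨h1, h2⟩
    exact ⟨⟨x, a.2.1.trans_le h1, h2.trans_lt b.2.2⟩, ⟨h1, h2⟩, rfl⟩

theorem isPreconnected_Icc_unit (a b : Ioo (0 : ℝ) 1) : IsPreconnected (Icc a b) := by
  rw [← Topology.IsInducing.subtypeVal.isPreconnected_image, image_val_Icc_unit]
  exact isPreconnected_Icc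

theorem isCompact_Icc_unit (a b : Ioo (0 : ℝ) 1) : IsCompact (Icc a b) := by
  rw [Topology.IsInducing.subtypeVal.isCompact_iff, image_val_Icc_unit]
  exact isCompact_Icc

/-- The vertical translation by `r` of the strip. -/
def shift (r : ℝ) : Strip ≃ₜ Strip := (Homeomorph.refl _).prodCongr (Homeomorph.addRight r)

@[simp] theorem shift_fst (r : ℝ) (p : Strip) : (shift r p).1 = p.1 := rfl

@[simp] theorem shift_snd (r : ℝ) (p : Strip) : (shift r p).2 = p.2 + r := rfl

@[simp] theorem shift_shift (r s : ℝ) (p : Strip) : shift r (shift s p) = shift (s + r) p :=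
  Prod.ext rfl (add_assoc _ _ _)

@[simp] theorem shift_zero (p : Strip) : shift 0 p = p := Prod.ext rfl (add_zero _)

theorem continuous_shift_mul (ε : ℝ) (p : Strip) : Continuous fun s : ℝ => shift (ε * s) p :=
  continuous_const.prodMk (show Continuous fun s : ℝ => p.2 + ε * s by fun_prop)

/-- `M` is bounded in the direction of `ε` over every compact part of the base. -/
def BddToward (ε : ℝ) (M : Set Strip) : Prop :=
  ∀ a b : Ioo (0 : ℝ) 1, ∃ B : ℝ, ∀ p ∈ M, a ≤ p.1 → p.1 ≤ b → ε * p.2 ≤ B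

/-- The points of the complement of `M` that can be joined, off `M`, to a vertical half line
in the direction of `ε` that avoids `M`. -/
def Side (ε : ℝ) (M : Set Strip) : Set Strip :=
  {p | ∃ q ∈ connectedComponentIn Mᶜ p, ∀ s : ℝ, 0 ≤ s → shift (ε * s) q ∉ M}

section Cut

variable {ε : ℝ} {M : Set Strip}

/-- Only the sign of `ε` matters; a map of degree `d` carries direction `ε` to `d * ε`. -/
theorem side_mul {c : ℝ} (hc : 0 < c) : Side (c * ε) M = Side ε M := by
  ext p
  constructor
  · rintro ⟨q, hq, h⟩
    refine ⟨q, hq, fun s hs => ?_⟩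
    have := h (s / c) (by positivity)
    rwa [mul_comm c, mul_assoc, mul_div_cancel₀ _ hc.ne'] at this
  · rintro ⟨q, hq, h⟩
    refine ⟨q, hq, fun s hs => ?_⟩
    rw [mul_comm c, mul_assoc]
    exact h _ (by positivity)

theorem notMem_of_mem_side {p : Strip} (hp : p ∈ Side ε M) : p ∉ M := by
  obtain ⟨q, hq, -⟩ := hp
  exact connectedComponentIn_nonempty_iff.1 ⟨q, hq⟩

theorem connectedComponentIn_subset_side {p : Strip} (hp : p ∈ Side ε M) :
    connectedComponentIn Mᶜ p ⊆ Side ε M := by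
  intro z hz
  obtain ⟨q, hq, h⟩ := hp
  refine ⟨q, ?_, h⟩
  rwa [← connectedComponentIn_eq hz]

theorem IsPreconnected.subset_side {S : Set Strip} (hS : IsPreconnected S)
    (hd : ∀ p ∈ S, p ∉ M) {p : Strip} (hpS : p ∈ S) (hp : p ∈ Side ε M) : S ⊆ Side ε M :=
  (hS.subset_connectedComponentIn hpS hd).trans (connectedComponentIn_subset_side hp)

theorem isOpen_side (hM : IsClosed M) : IsOpen (Side ε M) := by
  refine isOpen_iff_mem_nhds.2 fun p hp => Filter.mem_of_superset
    (hM.isOpen_compl.connectedComponentIn.mem_nhds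
      (mem_connectedComponentIn (notMem_of_mem_side hp))) (connectedComponentIn_subset_side hp)

theorem mem_side_of_forall {p : Strip} (h : ∀ s : ℝ, 0 ≤ s → shift (ε * s) p ∉ M) :
    p ∈ Side ε M :=
  ⟨p, mem_connectedComponentIn (by simpa using h 0 le_rfl), h⟩

theorem BddToward.exists_forall_shift_mem_side (hb : BddToward ε M) (hε : ε ≠ 0) (p : Strip) :
    ∃ N : ℕ, ∀ s : ℝ, N ≤ s → shift (ε * s) p ∈ Side ε M := by
  obtain ⟨B, hB⟩ := hb p.1 p.1
  have hε2 : 0 < ε * ε := mul_self_pos.2 hε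
  obtain ⟨N, hN⟩ := exists_nat_gt ((B - ε * p.2) / (ε * ε))
  refine ⟨N, fun s hs => mem_side_of_forall fun t ht hmem => ?_⟩
  have h1 := hB _ hmem le_rfl le_rfl
  rw [div_lt_iff₀ hε2] at hN
  simp only [shift_snd] at h1
  nlinarith [mul_nonneg hε2.le ht, mul_nonneg hε2.le (sub_nonneg.2 hs)]

/-- The rays belonging to two points enter the region beyond the bound `B` over the interval between
their abscissae, which is connected and misses `M`. -/
theorem BddToward.isPreconnected_side (hb : BddToward ε M) (hε : ε ≠ 0) :
    IsPreconnected (Side ε M) := by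
  have hε2 : 0 < ε * ε := mul_self_pos.2 hε
  refine isPreconnected_of_forall_pair fun p hp p' hp' => ?_
  obtain ⟨q, hq, h⟩ := id hp
  obtain ⟨q', hq', h'⟩ := id hp'
  obtain ⟨B, hB⟩ := hb (min q.1 q'.1) (max q.1 q'.1)
  have key : ∀ r : Strip, (∀ s : ℝ, 0 ≤ s → shift (ε * s) r ∉ M) →
      ∃ s : ℝ, 0 ≤ s ∧ B < ε * (shift (ε * s) r).2 := by
    intro r hr
    obtain ⟨N, hN⟩ := exists_nat_gt ((B - ε * r.2) / (ε * ε))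
    rw [div_lt_iff₀ hε2] at hN
    refine ⟨N, N.cast_nonneg, ?_⟩
    simp only [shift_snd]
    nlinarith
  obtain ⟨s, hs0, hs⟩ := key q h
  obtain ⟨s', hs0', hs'⟩ := key q' h'
  have hray : ∀ r : Strip, IsPreconnected ((fun s : ℝ => shift (ε * s) r) '' Ici 0) := by
    intro r
    exact isPreconnected_Ici.image _ (continuous_shift_mul ε r).continuousOn
  let P : Set Strip := Icc (min q.1 q'.1) (max q.1 q'.1) ×ˢ {t : ℝ | B < ε * t}
  have hP : IsPreconnected P := by
    refine (isPreconnected_Icc_unit _ _).prod (Convex.isPreconnected ?_)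
    exact convex_halfSpace_gt (LinearMap.isLinear (LinearMap.mulLeft ℝ ε)) B
  have hPM : ∀ p ∈ P, p ∉ M := fun z hz hzM => absurd (hB z hzM hz.1.1 hz.1.2) (not_le.2 hz.2)
  have mem0 : ∀ r : Strip, r ∈ (fun s : ℝ => shift (ε * s) r) '' Ici 0 := fun r =>
    ⟨0, self_mem_Ici, by simp⟩
  have h1 := IsPreconnected.union q hq (mem0 q) isPreconnected_connectedComponentIn (hray q)
  have h1' := IsPreconnected.union q' hq' (mem0 q') isPreconnected_connectedComponentIn (hray q')
  have h2 := h1.union (shift (ε * s) q) (Or.inr ⟨s, hs0, rfl⟩)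
    (⟨⟨min_le_left _ _, le_max_left _ _⟩, hs⟩ : shift (ε * s) q ∈ P) hP
  have h3 := h2.union (shift (ε * s') q')
    (Or.inr (⟨⟨min_le_right _ _, le_max_right _ _⟩, hs'⟩ : shift (ε * s') q' ∈ P))
    (Or.inr ⟨s', hs0', rfl⟩) h1'
  have hmp : p ∈ connectedComponentIn Mᶜ p := mem_connectedComponentIn (notMem_of_mem_side hp)
  refine ⟨_, ?_, Or.inl (Or.inl (Or.inl hmp)),
    Or.inr (Or.inl (mem_connectedComponentIn (notMem_of_mem_side hp'))), h3⟩
  refine h3.subset_side ?_ (Or.inl (Or.inl (Or.inl hmp))) hp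
  rintro z (((hz | ⟨t, ht, rfl⟩) | hz) | hz | ⟨t, ht, rfl⟩)
  · exact connectedComponentIn_subset _ _ hz
  · exact h t ht
  · exact hPM z hz
  · exact connectedComponentIn_subset _ _ hz
  · exact h' t ht

/-- A connected set off `M` that reaches arbitrarily far in the direction of `ε` lies on the
corresponding side of `M`. -/
theorem BddToward.subset_side (hb : BddToward ε M) (hε : ε ≠ 0) {S : Set Strip}
    (hS : IsPreconnected S) (hd : ∀ p ∈ S, p ∉ M) (p : Strip)
    (hp : ∀ N : ℕ, ∃ s : ℝ, N ≤ s ∧ shift (ε * s) p ∈ S) : S ⊆ Side ε M := by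
  obtain ⟨N, hN⟩ := hb.exists_forall_shift_mem_side hε p
  obtain ⟨s, hs, hsS⟩ := hp N
  exact hS.subset_side hd hsS (hN s hs)

/-! ### Cuts and their levels -/

/-- `M` is a connected closed subset of the strip that separates its two vertical ends and is
disjoint from its integral translates. -/
structure IsCut (M : Set Strip) : Prop where
  isClosed : IsClosed M
  isPreconnected : IsPreconnected M
  exists_mem : ∀ x, ∃ t, (x, t) ∈ M
  bdd : ∀ a b : Ioo (0 : ℝ) 1, ∃ B : ℝ, ∀ p ∈ M, a ≤ p.1 → p.1 ≤ b → |p.2| ≤ B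
  eq_zero_of_shift_mem : ∀ p ∈ M, ∀ n : ℤ, shift n p ∈ M → n = 0

theorem IsCut.bddToward (hM : IsCut M) (ε : ℝ) : BddToward ε M := by
  intro a b
  obtain ⟨B, hB⟩ := hM.bdd a b
  refine ⟨|ε| * B, fun p hp h1 h2 => (le_abs_self _).trans ?_⟩
  rw [abs_mul]
  exact mul_le_mul_of_nonneg_left (hB p hp h1 h2) (abs_nonneg _)

theorem isPathConnected_vertical_ray (ε : ℝ) (r : Strip) :
    IsPathConnected ((fun s : ℝ => shift (ε * s) r) '' Ici 0) :=
  ((convex_Ici 0).isPathConnected nonempty_Ici).image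
    (continuous_shift_mul ε r)

/-- If the sides met, an upward and a downward ray would be joined by a path off `M`, forming a
closed set `D`. A cut need not be path connected, but it lies in one component of the open set `Dᶜ`,
which is. So a path in `Dᶜ` leads from the least to the greatest abscissa of `D`, and it must cross
a path in `D` from above it to below it. -/
theorem IsCut.disjoint_side (hM : IsCut M) : Disjoint (Side 1 M) (Side (-1) M) := by
  rw [Set.disjoint_left]
  rintro p ⟨q, hq, h⟩ ⟨q', hq', h'⟩
  have hpM : p ∈ Mᶜ := connectedComponentIn_nonempty_iff.1 ⟨q, hq⟩
  have hE : IsPathConnected (connectedComponentIn Mᶜ p) :=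
    hM.isClosed.isOpen_compl.connectedComponentIn.isConnected_iff_isPathConnected.1
      (isConnected_connectedComponentIn_iff.2 hpM)
  obtain ⟨γ, hγ⟩ := hE.joinedIn q hq q' hq'
  have hK : IsCompact (range γ) := isCompact_range γ.continuous
  obtain ⟨_, ⟨s₁, rfl⟩, hmin⟩ := hK.exists_isMinOn ⟨_, mem_range_self 0⟩
    (f := fun z : Strip => (z.1 : ℝ)) (by fun_prop)
  obtain ⟨_, ⟨s₂, rfl⟩, hmax⟩ := hK.exists_isMaxOn ⟨_, mem_range_self 0⟩
    (f := fun z : Strip => (z.1 : ℝ)) (by fun_prop)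
  obtain ⟨t₁, ht₁⟩ := hM.exists_mem (γ s₁).1
  obtain ⟨t₂, ht₂⟩ := hM.exists_mem (γ s₂).1
  have : PathConnectedSpace unitInterval := isPathConnected_iff_pathConnectedSpace.1
    ((convex_Icc (0 : ℝ) 1).isPathConnected (nonempty_Icc.2 zero_le_one))
  let D : Set Strip := ((fun s : ℝ => shift (1 * s) q) '' Ici 0 ∪ range γ) ∪
    (fun s : ℝ => shift (-1 * s) q') '' Ici 0
  have hDp : IsPathConnected D := by
    refine ((isPathConnected_vertical_ray _ _).union (isPathConnected_range γ.continuous)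
      ⟨q, ⟨0, self_mem_Ici, by simp⟩, 0, γ.source⟩).union (isPathConnected_vertical_ray _ _)
      ⟨q', Or.inr ⟨1, γ.target⟩, 0, self_mem_Ici, by simp⟩
  have hDM : ∀ z ∈ D, z ∉ M := by
    rintro z ((⟨s, hs, rfl⟩ | ⟨s, rfl⟩) | ⟨s, hs, rfl⟩)
    · exact h s hs
    · exact connectedComponentIn_subset _ _ (hγ s)
    · exact h' s hs
  have hDx : ∀ z ∈ D, ((γ s₁).1 : ℝ) ≤ z.1 ∧ (z.1 : ℝ) ≤ (γ s₂).1 := by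
    have hall : ∀ s, ((γ s₁).1 : ℝ) ≤ (γ s).1 ∧ ((γ s).1 : ℝ) ≤ (γ s₂).1 := fun s =>
      ⟨hmin (mem_range_self s), hmax (mem_range_self s)⟩
    rintro z ((⟨s, hs, rfl⟩ | ⟨s, rfl⟩) | ⟨s, hs, rfl⟩)
    · simpa using hall 0
    · exact hall s
    · simpa using hall 1
  have hDc : IsClosed D := by
    have e1 : (fun s : ℝ => shift (1 * s) q) '' Ici 0 = {z : Strip | z.1 = q.1 ∧ q.2 ≤ z.2} := by
      ext z
      constructor
      · rintro ⟨s, hs, rfl⟩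
        exact ⟨rfl, by simpa using hs⟩
      · rintro ⟨h1, h2⟩
        exact ⟨z.2 - q.2, sub_nonneg.2 h2, Prod.ext h1.symm (by simp)⟩
    have e2 : (fun s : ℝ => shift (-1 * s) q') '' Ici 0 =
        {z : Strip | z.1 = q'.1 ∧ z.2 ≤ q'.2} := by
      ext z
      constructor
      · rintro ⟨s, hs, rfl⟩
        exact ⟨rfl, by simpa using hs⟩
      · rintro ⟨h1, h2⟩
        exact ⟨q'.2 - z.2, sub_nonneg.2 h2, Prod.ext h1.symm (by simp)⟩
    refine IsClosed.union (IsClosed.union ?_ hK.isClosed) ?_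
    · rw [e1]
      exact (isClosed_eq continuous_fst continuous_const).inter
        (isClosed_le continuous_const continuous_snd)
    · rw [e2]
      exact (isClosed_eq continuous_fst continuous_const).inter
        (isClosed_le continuous_snd continuous_const)
  have hMD : M ⊆ Dᶜ := fun z hz hzD => hDM z hzD hz
  have hV : IsPathConnected (connectedComponentIn Dᶜ ((γ s₁).1, t₁)) :=
    hDc.isOpen_compl.connectedComponentIn.isConnected_iff_isPathConnected.1
      (isConnected_connectedComponentIn_iff.2 (hMD ht₁))
  obtain ⟨η, hη⟩ := hV.joinedIn _ (mem_connectedComponentIn (hMD ht₁)) _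
    (hM.isPreconnected.subset_connectedComponentIn ht₁ hMD ht₂)
  obtain ⟨B, hB⟩ := ((isCompact_range η.continuous).image continuous_snd).isBounded.exists_norm_le
  have hB' : ∀ s, |(η s).2| ≤ B := fun s => hB _ ⟨_, ⟨s, rfl⟩, rfl⟩
  obtain ⟨δ, hδ⟩ := hDp.joinedIn (shift (1 * max 0 (B - q.2)) q)
    (Or.inl (Or.inl ⟨_, mem_Ici.2 (le_max_left _ _), rfl⟩)) (shift (-1 * max 0 (B + q'.2)) q')
    (Or.inr ⟨_, mem_Ici.2 (le_max_left _ _), rfl⟩)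
  obtain ⟨s, t, hst, hst'⟩ := exists_path_crossing (x := fun z : Strip => (z.1 : ℝ))
    (y := fun z : Strip => z.2) (by fun_prop) (by fun_prop) η δ
    (fun s => (hDx _ (hδ s)).1) (fun s => (hDx _ (hδ s)).2)
    (fun s => by
      have := (abs_le.1 (hB' s)).2
      have := le_max_right 0 (B - q.2)
      simp only [shift_snd]; linarith)
    (fun s => by
      have := (abs_le.1 (hB' s)).1
      have := le_max_right 0 (B + q'.2)
      simp only [shift_snd]; linarith)
  have hEq : η s = δ t := Prod.ext (Subtype.ext hst) hst'
  exact connectedComponentIn_subset _ _ (hη s) (hEq ▸ hδ t)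

namespace IsCut

theorem nonempty (hM : IsCut M) : M.Nonempty :=
  let ⟨_, ht⟩ := hM.exists_mem ⟨1 / 2, by norm_num, by norm_num⟩
  ⟨_, ht⟩

/-- For the extreme point `q` of `M` on the vertical line through `p`, the ray from `shift ε q`
misses `M`. The whole translate of `M` follows, being connected and disjoint from `M`. -/
theorem shift_mem_side (hM : IsCut M) (hε : ε = 1 ∨ ε = -1) {p : Strip} (hp : p ∈ M) :
    shift ε p ∈ Side ε M := by
  have hne : ∀ z ∈ M, shift ε z ∉ M := by
    intro z hz hz'
    rcases hε with rfl | rfl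
    · exact absurd (hM.eq_zero_of_shift_mem z hz 1 (by simpa using hz')) (by norm_num)
    · exact absurd (hM.eq_zero_of_shift_mem z hz (-1) (by simpa using hz')) (by norm_num)
  have hε2 : ε * ε = 1 := by rcases hε with rfl | rfl <;> norm_num
  obtain ⟨B, hB⟩ := hM.bdd p.1 p.1
  have hK : IsCompact (M ∩ ({p.1} ×ˢ Icc (-B) B)) :=
    (isCompact_singleton.prod isCompact_Icc).inter_left hM.isClosed
  obtain ⟨q, ⟨hqM, hq1, -⟩, hmax⟩ := hK.exists_isMaxOn
    ⟨p, hp, rfl, abs_le.1 (hB p hp le_rfl le_rfl)⟩ (f := fun z : Strip => ε * z.2) (by fun_prop)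
  have hqs : shift ε q ∈ Side ε M := by
    refine mem_side_of_forall fun s hs hmem => ?_
    have hx : (shift (ε * s) (shift ε q)).1 = p.1 := hq1
    have h1 := hmax (⟨hmem, hx, abs_le.1 (hB _ hmem hx.ge hx.le)⟩ :
      shift (ε * s) (shift ε q) ∈ M ∩ ({p.1} ×ˢ Icc (-B) B))
    simp only [shift_snd, mem_ofPred_eq] at h1
    nlinarith
  refine (hM.isPreconnected.image (shift ε) (shift ε).continuous.continuousOn).subset_side
    ?_ ⟨q, hqM, rfl⟩ hqs ⟨p, hp, rfl⟩
  rintro _ ⟨z, hz, rfl⟩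
  exact hne z hz

theorem notMem_neg_side (hM : IsCut M) (hε : ε = 1 ∨ ε = -1) {p : Strip} (hp : p ∈ Side ε M) :
    p ∉ Side (-ε) M := by
  rcases hε with rfl | rfl
  · exact Set.disjoint_left.1 hM.disjoint_side hp
  · rw [neg_neg]; exact Set.disjoint_right.1 hM.disjoint_side hp

/-- The translated side is connected and reaches the end. It misses `M`, because a point of `M`
moved back by `ε` is on the opposite side. -/
theorem shift_mem_side_of_mem_side (hM : IsCut M) (hε : ε = 1 ∨ ε = -1) {p : Strip}
    (hp : p ∈ Side ε M) : shift ε p ∈ Side ε M := by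
  have hε0 : ε ≠ 0 := by rcases hε with rfl | rfl <;> norm_num
  have hS := ((hM.bddToward ε).isPreconnected_side hε0).image (shift ε)
    (shift ε).continuous.continuousOn
  refine (hM.bddToward ε).subset_side hε0 hS ?_ p (fun N => ?_) ⟨p, hp, rfl⟩
  · rintro _ ⟨z, hz, rfl⟩ hzM
    have := hM.shift_mem_side (ε := -ε) (by rcases hε with rfl | rfl <;> simp) hzM
    rw [shift_shift, add_neg_cancel, shift_zero] at this
    exact hM.notMem_neg_side hε hz this
  · obtain ⟨K, hK⟩ := (hM.bddToward ε).exists_forall_shift_mem_side hε0 p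
    refine ⟨max K N + 1, (le_max_right (K : ℝ) N).trans (by simp), shift (ε * (max K N : ℝ)) p,
      hK _ (le_max_left _ _), ?_⟩
    rw [shift_shift, mul_add, mul_one, Nat.cast_max]

/-- The complement of `M` may have components on neither side. Such a component together with `M`,
moved down by 1, is connected and misses `M`, hence lies below `M`. These pockets are why
`exists_level` puts `p` above the translate `n` only when `n + 1 < φ p`. -/
theorem mem_side_or (hM : IsCut M) (p : Strip) :
    p ∈ Side 1 M ∨ shift (-1) p ∈ Side (-1) M := by
  refine or_iff_not_imp_left.2 fun hp => ?_
  by_cases hpM : p ∈ M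
  · exact hM.shift_mem_side (Or.inr rfl) hpM
  have hS := isPreconnected_connectedComponentIn_union_compl hM.isPreconnected hM.isClosed
    hM.nonempty hpM
  obtain ⟨m, hm⟩ := hM.nonempty
  refine (hS.image (shift (-1)) (shift (-1)).continuous.continuousOn).subset_side ?_
    ⟨m, Or.inr hm, rfl⟩ (hM.shift_mem_side (Or.inr rfl) hm)
    ⟨p, Or.inl (mem_connectedComponentIn hpM), rfl⟩
  rintro _ ⟨z, hz | hz, rfl⟩ hzM
  · have h1 := hM.shift_mem_side (Or.inl rfl) hzM
    rw [shift_shift, neg_add_cancel, shift_zero] at h1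
    refine hp (connectedComponentIn_subset_side h1 ?_)
    rw [← connectedComponentIn_eq hz]
    exact mem_connectedComponentIn hpM
  · exact absurd (hM.eq_zero_of_shift_mem z hz (-1) (by simpa using hzM)) (by norm_num)

/-- The number of the translate of `M` just above a point. -/
theorem exists_level (hM : IsCut M) : ∃ φ : Strip → ℤ,
    (∀ p, shift (-(φ p)) p ∈ Side (-1) M) ∧
    (∀ p, ∀ n : ℤ, shift (-n) p ∈ Side (-1) M → φ p ≤ n) ∧
    (∀ p, ∀ n : ℤ, shift (-n) p ∈ Side 1 M → n < φ p) ∧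
    (∀ p, ∀ n : ℤ, φ p < n → shift (-n) p ∈ Side (-1) M) ∧
    (∀ p, ∀ n : ℤ, n + 1 < φ p → shift (-n) p ∈ Side 1 M) := by
  have hmono : ∀ (p : Strip) (k : ℕ) (n : ℤ), shift (-n) p ∈ Side (-1) M →
      shift (-(n + k : ℤ)) p ∈ Side (-1) M := by
    intro p k n h
    induction k with
    | zero => simpa using h
    | succ k ih =>
      have := hM.shift_mem_side_of_mem_side (Or.inr rfl) ih
      rw [shift_shift] at this
      convert this using 3
      push_cast; ring
  have hsep : ∀ (p : Strip) (m n : ℤ), shift (-m) p ∈ Side (-1) M → shift (-n) p ∈ Side 1 M →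
      n < m := by
    intro p m n hm hn
    by_contra! hle
    obtain ⟨k, rfl⟩ := Int.le.dest hle
    exact Set.disjoint_left.1 hM.disjoint_side hn (hmono p k m hm)
  have hex : ∀ p : Strip, ∃ n : ℤ, shift (-n) p ∈ Side (-1) M ∧
      ∀ m : ℤ, shift (-m) p ∈ Side (-1) M → n ≤ m := by
    intro p
    obtain ⟨N, hN⟩ := (hM.bddToward (-1)).exists_forall_shift_mem_side (by norm_num) p
    obtain ⟨K, hK⟩ := (hM.bddToward 1).exists_forall_shift_mem_side (by norm_num) p
    have hN' : shift (-((N : ℤ) : ℝ)) p ∈ Side (-1) M := by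
      simpa only [neg_one_mul, Int.cast_natCast] using hN N le_rfl
    have hK' : shift (-((-K : ℤ) : ℝ)) p ∈ Side 1 M := by
      simpa only [one_mul, Int.cast_natCast, Int.cast_neg, neg_neg] using hK K le_rfl
    exact Int.exists_least_of_bdd ⟨-K, fun z hz => (hsep p z (-K) hz hK').le⟩ ⟨N, hN'⟩
  choose φ hφ hmin using hex
  have hsub : ∀ (p : Strip) (n : ℤ), shift (-1) (shift (-n) p) = shift (-(n + 1 : ℤ)) p := by
    intro p n
    rw [shift_shift]; push_cast; ring_nf
  refine ⟨φ, hφ, hmin, fun p n hn => hsep p _ n (hφ p) hn, fun p n hn => ?_, fun p n hn => ?_⟩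
  · have h := (hM.mem_side_or (shift (-(n - 1 : ℤ)) p)).resolve_left fun h => by
      have := hsep p _ _ (hφ p) h
      omega
    rwa [hsub, sub_add_cancel] at h
  · refine (hM.mem_side_or _).resolve_right fun h => ?_
    rw [hsub] at h
    have := hmin p _ h
    omega

end IsCut

theorem IsCut.exists_forall_shift_mem_side (hM : IsCut M) (hε : ε = 1 ∨ ε = -1) {N : Set Strip}
    (hN : IsPreconnected N) (hne : N.Nonempty)
    (hd : ∀ p ∈ N, ∀ n : ℤ, shift n p ∈ M → n = 0) :
    ∃ j : ℕ, ∀ p ∈ N, shift (ε * j) p ∈ Side ε M := by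
  have hε0 : ε ≠ 0 := by rcases hε with rfl | rfl <;> norm_num
  obtain ⟨p, hp⟩ := hne
  obtain ⟨j, hj⟩ := (hM.bddToward ε).exists_forall_shift_mem_side hε0 p
  -- The extra 1 makes the translation nontrivial, so that the moved copy of `N` misses `M`.
  refine ⟨j + 1, fun q hq => ?_⟩
  refine (hN.image (shift (ε * (j + 1 : ℕ)))
    (shift (ε * (j + 1 : ℕ))).continuous.continuousOn).subset_side ?_ ⟨p, hp, rfl⟩
    (hj _ (by simp)) ⟨q, hq, rfl⟩
  rintro _ ⟨z, hz, rfl⟩ hzM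
  rcases hε with rfl | rfl
  · have := hd z hz (j + 1) (by simpa using hzM)
    omega
  · have := hd z hz (-(j + 1)) (by convert hzM using 3; push_cast; ring)
    omega

/-! ### Levels under an equivariant homeomorphism -/

/-- A self-homeomorphism of the strip that lifts a self-map of the annulus of degree `d`. -/
def IsEquivariant (F : Strip ≃ₜ Strip) (d : ℤ) : Prop :=
  ∀ (p : Strip) (n : ℤ), F (shift n p) = shift (d * n : ℤ) (F p)

section Dynamics

variable {F : Strip ≃ₜ Strip} {d : ℤ}

/-- A uniform number `j` of translations carries `F⁻¹(M)` to the opposite side of `M`. Hence the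
image of a side, moved by `d * ε * j`, cannot meet `M`; it is connected and reaches the end in
direction `d * ε`. -/
theorem IsCut.exists_forall_shift_map_mem_side (hM : IsCut M) (hF : IsEquivariant F d)
    (hd : d ≠ 0) (hFM : ∀ p ∈ M, ∀ n : ℤ, shift n (F p) ∈ M → n = 0)
    (hε : ε = 1 ∨ ε = -1) :
    ∃ j : ℕ, ∀ p ∈ Side ε M, shift (d * ε * j) (F p) ∈ Side (d * ε) M := by
  have hε0 : ε ≠ 0 := by rcases hε with rfl | rfl <;> norm_num
  have hd0 : (d : ℝ) ≠ 0 := by exact_mod_cast hd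
  obtain ⟨e, rfl⟩ : ∃ e : ℤ, ε = e := by
    rcases hε with rfl | rfl
    · exact ⟨1, by simp⟩
    · exact ⟨-1, by simp⟩
  obtain ⟨j, hj⟩ := hM.exists_forall_shift_mem_side (ε := -e) (N := F.symm '' M)
    (by rcases hε with h | h <;> simp [h])
    (hM.isPreconnected.image _ F.symm.continuous.continuousOn) (hM.nonempty.image _) (by
      rintro _ ⟨p, hp, rfl⟩ n hn
      have h1 := hFM _ hn (-(d * n)) (by
        rw [hF, F.apply_symm_apply, shift_shift]
        simpa using hp)
      simpa [hd] using h1)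
  refine ⟨j, fun p hp => ?_⟩
  have hS := (((hM.bddToward e).isPreconnected_side hε0).image F F.continuous.continuousOn).image
    (shift (d * e * j)) (shift (d * e * j)).continuous.continuousOn
  refine (hM.bddToward (d * e)).subset_side (mul_ne_zero hd0 hε0) hS ?_ (F p) (fun N => ?_)
    ⟨_, ⟨p, hp, rfl⟩, rfl⟩
  · rintro _ ⟨_, ⟨z, hz, rfl⟩, rfl⟩ hzM
    have h1 := hj _ ⟨_, hzM, rfl⟩
    have h2 : shift (d * e * j) (F z) = F (shift (e * j : ℤ) z) := by
      rw [hF]; push_cast; rw [mul_assoc]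
    rw [h2, F.symm_apply_apply, shift_shift] at h1
    push_cast at h1
    rw [neg_mul, add_neg_cancel, shift_zero] at h1
    exact hM.notMem_neg_side hε hz h1
  · obtain ⟨K, hK⟩ := (hM.bddToward e).exists_forall_shift_mem_side hε0 p
    refine ⟨max K N + j, (le_max_right (K : ℝ) N).trans (by simp), F (shift (e * max K N : ℤ) p),
      ⟨_, ?_, rfl⟩, ?_⟩
    · have := hK (max K N) (le_max_left _ _)
      push_cast
      exact this
    · rw [hF, shift_shift]; push_cast; ring_nf

theorem IsCut.exists_level_map (hM : IsCut M) (hF : IsEquivariant F d) (hd : d ≠ 0)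
    (hFM : ∀ p ∈ M, ∀ n : ℤ, shift n (F p) ∈ M → n = 0) :
    ∃ (φ : Strip → ℤ) (c : ℝ), (∀ p, |(φ (F p) : ℝ) - d * φ p| ≤ c) ∧
      (∀ p, ∀ᶠ q in nhds p, |(φ q : ℝ) - φ p| ≤ c) ∧
      (∀ p (n : ℤ), φ (shift n p) = φ p + n) ∧
      (∀ p, ∀ n : ℤ, shift (-n) p ∈ Side (-1) M → φ p ≤ n) ∧
      (∀ p, ∀ n : ℤ, shift (-n) p ∈ Side 1 M → n < φ p) ∧
      (∀ p, ∀ n : ℤ, φ p < n → shift (-n) p ∈ Side (-1) M) ∧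
      (∀ p, ∀ n : ℤ, n + 1 < φ p → shift (-n) p ∈ Side 1 M) := by
  obtain ⟨φ, h0, hlo, hup, hlo', hup'⟩ := hM.exists_level
  obtain ⟨j₁, hj₁⟩ := hM.exists_forall_shift_map_mem_side hF hd hFM (Or.inl rfl)
  obtain ⟨j₂, hj₂⟩ := hM.exists_forall_shift_map_mem_side hF hd hFM (Or.inr rfl)
  have hmap : ∀ p, |φ (F p) - d * φ p| ≤ |d| * (2 + j₁ + j₂) := by
    intro p
    -- The point `p` is above the translate `φ p - 2` and below the translate `φ p + 1`. Applying
    -- `F` bounds `φ (F p)` from both sides, with the roles of the bounds exchanged if `d < 0`.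
    have h1 := hj₁ _ (hup' p (φ p - 2) (by omega))
    have h2 := hj₂ _ (hlo' p (φ p + 1) (by omega))
    have e1 : F (shift (-(φ p - 2 : ℤ)) p) = shift (-(d * (φ p - 2) : ℤ)) (F p) := by
      have := hF p (-(φ p - 2))
      push_cast at this ⊢
      rw [this]; ring_nf
    have e2 : F (shift (-(φ p + 1 : ℤ)) p) = shift (-(d * (φ p + 1) : ℤ)) (F p) := by
      have := hF p (-(φ p + 1))
      push_cast at this ⊢
      rw [this]; ring_nf
    rw [e1, shift_shift] at h1
    rw [e2, shift_shift] at h2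
    have f1 : (-(d * (φ p - 2) : ℤ) + d * 1 * j₁ : ℝ) = -(d * (φ p - 2) - d * j₁ : ℤ) := by
      push_cast; ring
    have f2 : (-(d * (φ p + 1) : ℤ) + d * -1 * j₂ : ℝ) = -(d * (φ p + 1) + d * j₂ : ℤ) := by
      push_cast; ring
    rw [f1] at h1
    rw [f2] at h2
    have hj1 : (0 : ℤ) ≤ j₁ := Int.natCast_nonneg _
    have hj2 : (0 : ℤ) ≤ j₂ := Int.natCast_nonneg _
    rcases lt_or_gt_of_ne hd with hneg | hpos
    · have s1 : Side ((d : ℝ) * 1) M = Side (-1) M := by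
        rw [← side_mul (ε := -1) (c := -d) (by exact_mod_cast neg_pos.2 hneg)]; ring_nf
      have s2 : Side ((d : ℝ) * -1) M = Side 1 M := by
        rw [← side_mul (ε := 1) (c := -d) (by exact_mod_cast neg_pos.2 hneg)]; ring_nf
      rw [s1] at h1
      rw [s2] at h2
      have g1 := hlo _ _ h1
      have g2 := hup _ _ h2
      rw [abs_of_neg hneg, abs_le]
      constructor <;> nlinarith [mul_nonneg (neg_pos.2 hneg).le hj1,
        mul_nonneg (neg_pos.2 hneg).le hj2]
    · have s1 : Side ((d : ℝ) * 1) M = Side 1 M := side_mul (by exact_mod_cast hpos)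
      have s2 : Side ((d : ℝ) * -1) M = Side (-1) M := side_mul (by exact_mod_cast hpos)
      rw [s1] at h1
      rw [s2] at h2
      have g1 := hup _ _ h1
      have g2 := hlo _ _ h2
      rw [abs_of_pos hpos, abs_le]
      constructor <;> nlinarith [mul_nonneg hpos.le hj1, mul_nonneg hpos.le hj2]
  have hle : ∀ p (n : ℤ), φ (shift n p) ≤ φ p + n := by
    intro p n
    refine hlo _ _ ?_
    rw [shift_shift]
    convert h0 p using 2
    push_cast; ring_nf
  have hd1 : (1 : ℝ) ≤ |d| := by exact_mod_cast Int.one_le_abs hd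
  refine ⟨φ, |d| * (2 + j₁ + j₂), fun p => by exact_mod_cast hmap p, fun p => ?_,
    fun p n => le_antisymm (hle p n) ?_, hlo, hup, hlo', hup'⟩
  · have o1 := (isOpen_side hM.isClosed).preimage (shift (-(φ p + 1 : ℤ))).continuous |>.mem_nhds
      (hlo' p _ (lt_add_one _))
    have o2 := (isOpen_side hM.isClosed).preimage (shift (-(φ p - 2 : ℤ))).continuous |>.mem_nhds
      (hup' p (φ p - 2) (by omega))
    filter_upwards [o1, o2] with q hq1 hq2
    have g1 : (φ q : ℝ) ≤ φ p + 1 := by exact_mod_cast hlo q _ hq1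
    have g2 : (φ p : ℝ) - 2 < φ q := by exact_mod_cast hup q _ hq2
    -- The same constant serves for the local variation of `φ`, which is at most 2.
    have : (2 : ℝ) ≤ (|d| : ℤ) * (2 + j₁ + j₂) := by
      nlinarith [(Nat.cast_nonneg j₁ : (0 : ℝ) ≤ j₁), (Nat.cast_nonneg j₂ : (0 : ℝ) ≤ j₂)]
    rw [abs_le]
    constructor <;> linarith
  · have := hle (shift n p) (-n)
    rw [shift_shift] at this
    simp only [Int.cast_neg, add_neg_cancel, shift_zero] at this
    omega

end Dynamics

/-! ### Expanding heights as limits of levels -/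

/-- A function that is almost multiplied by `d` under `F` is close to one that is multiplied
by `d`. -/
theorem exists_continuousMap_comp_eq_mul {X : Type*} [TopologicalSpace X] {F : X → X}
    (hF : Continuous F) {φ : X → ℝ} {d c : ℝ} (hd : 1 < |d|)
    (hφF : ∀ p, |φ (F p) - d * φ p| ≤ c) (hφ : ∀ p, ∀ᶠ q in nhds p, |φ q - φ p| ≤ c) :
    ∃ H : C(X, ℝ), (∀ p, H (F p) = d * H p) ∧ ∃ C, ∀ p, |H p - φ p| ≤ C := by
  have hd0 : d ≠ 0 := by rintro rfl; norm_num at hd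
  have hdp : 0 < |d| := one_pos.trans hd
  have hr : |d|⁻¹ < 1 := inv_lt_one_of_one_lt₀ hd
  let a : ℕ → X → ℝ := fun k p => φ (F^[k] p) / d ^ k
  have ha : ∀ p k, dist (a k p) (a (k + 1) p) ≤ c / |d| * |d|⁻¹ ^ k := by
    intro p k
    have : a (k + 1) p - a k p = (φ (F (F^[k] p)) - d * φ (F^[k] p)) / d ^ (k + 1) := by
      simp only [a, Function.iterate_succ_apply']
      rw [pow_succ]
      field_simp
    rw [dist_comm, Real.dist_eq, this, abs_div, abs_pow, pow_succ', ← div_div, inv_pow,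
      ← div_eq_mul_inv]
    have := hφF (F^[k] p)
    gcongr
  choose H hH using fun p => cauchySeq_tendsto_of_complete
    (cauchySeq_of_le_geometric _ _ hr (ha p))
  have hdist : ∀ p k, |a k p - H p| ≤ c / |d| * |d|⁻¹ ^ k / (1 - |d|⁻¹) := fun p k =>
    dist_le_of_le_geometric_of_tendsto _ _ hr (ha p) (hH p) k
  have hcont : Continuous H := by
    rw [continuous_iff_continuousAt]
    intro p
    rw [Metric.continuousAt_iff']
    intro δ hδ
    have hlim : Filter.Tendsto (fun k : ℕ => (2 * (c / |d| / (1 - |d|⁻¹)) + c) * |d|⁻¹ ^ k)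
        Filter.atTop (nhds ((2 * (c / |d| / (1 - |d|⁻¹)) + c) * 0)) :=
      (tendsto_pow_atTop_nhds_zero_of_lt_one (by positivity) hr).const_mul _
    rw [mul_zero] at hlim
    obtain ⟨k, hk⟩ := (hlim.eventually_lt_const hδ).exists
    -- The limit is continuous although `φ` is not: near `p` the jumps of `φ ∘ F^[k]` are at most
    -- `c`, and division by `d ^ k` makes them small.
    filter_upwards [(hF.iterate k).continuousAt.eventually (hφ (F^[k] p))] with q hq
    have h1 := hdist p k
    have h2 := hdist q k
    have h3 : |a k q - a k p| ≤ c * |d|⁻¹ ^ k := by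
      rw [← sub_div, abs_div, abs_pow, inv_pow, ← div_eq_mul_inv]
      gcongr
    rw [Real.dist_eq]
    have e : c / |d| * |d|⁻¹ ^ k / (1 - |d|⁻¹) = c / |d| / (1 - |d|⁻¹) * |d|⁻¹ ^ k := by ring
    rw [e] at h1 h2
    rw [abs_le] at h1 h2 h3
    refine lt_of_le_of_lt (abs_le.2 ⟨?_, ?_⟩) hk <;> linarith
  refine ⟨⟨H, hcont⟩, fun p => ?_, c / |d| / (1 - |d|⁻¹), fun p => ?_⟩
  · refine tendsto_nhds_unique (hH (F p)) ?_
    have := ((hH p).comp (Filter.tendsto_add_atTop_nat 1)).const_mul d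
    refine this.congr fun k => ?_
    simp only [a, Function.comp, Function.iterate_succ_apply, pow_succ]
    field_simp
  · rw [abs_sub_comm]
    simpa [a] using hdist p 0

section Dynamics

variable {F : Strip ≃ₜ Strip} {d : ℤ}

theorem IsEquivariant.pow (hF : IsEquivariant F d) (k : ℕ) : IsEquivariant (F ^ k) (d ^ k) := by
  induction k with
  | zero => intro p n; simp
  | succ k ih =>
    intro p n
    rw [pow_succ', pow_succ' d]
    simp only [Homeomorph.mul_apply]
    rw [ih p n, hF, mul_assoc]

/-- Iteration multiplies `H` by powers of `d`, so every point with `0 < ε * H p` eventually enters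
the translated side. The set is thus a union of connected preimages of that side, and consecutive
ones share far translates of any point. -/
theorem isPreconnected_of_expanding {ε : ℝ} (hε : ε = 1 ∨ ε = -1) (hM : IsCut M)
    (hF : IsEquivariant F d) (hd : 1 < |d|) {H : Strip → ℝ} (hH : ∀ p, H (F p) = d * H p)
    {r C : ℝ} (h1 : ∀ p, shift r p ∈ Side ε M → 0 < ε * H p)
    (h2 : ∀ p, C < ε * H p → shift r p ∈ Side ε M) : IsPreconnected {p | 0 < ε * H p} := by
  have hε0 : ε ≠ 0 := by rcases hε with rfl | rfl <;> norm_num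
  have hd1 : (1 : ℝ) < |(d : ℝ)| := by exact_mod_cast hd
  have hHk : ∀ k p, H ((F ^ k) p) = d ^ k * H p := by
    intro k
    induction k with
    | zero => simp
    | succ k ih =>
      intro p
      rw [pow_succ', Homeomorph.mul_apply, hH, ih, pow_succ']; ring
  -- Even iterates only: they preserve the sign of `H` also when `d < 0`.
  let G : ℕ → (Strip ≃ₜ Strip) := fun k => (F ^ (2 * k)).trans (shift r)
  have hG : ∀ k p, G k p = shift r ((F ^ (2 * k)) p) := fun k p => rfl
  have hunion : {p | 0 < ε * H p} = ⋃ k, G k ⁻¹' Side ε M := by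
    ext p
    rw [mem_iUnion]
    constructor
    · intro hp
      obtain ⟨k, hk⟩ := pow_unbounded_of_one_lt (C / (ε * H p))
        (one_lt_pow₀ hd1 two_ne_zero)
      refine ⟨k, ?_⟩
      rw [mem_preimage, hG]
      refine h2 _ ?_
      rw [div_lt_iff₀ hp, ← pow_mul, pow_mul, sq_abs, ← pow_mul] at hk
      rw [hHk]
      linarith
    · rintro ⟨k, hk⟩
      rw [mem_preimage, hG] at hk
      have := h1 _ hk
      rw [hHk, pow_mul, mul_left_comm] at this
      exact pos_of_mul_pos_right this (by positivity)
  rw [hunion]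
  refine IsPreconnected.iUnion_of_chain (fun k => ?_) fun k => ?_
  · rw [← Homeomorph.image_symm]
    exact ((hM.bddToward ε).isPreconnected_side hε0).image _ (G k).symm.continuous.continuousOn
  · obtain ⟨e, rfl⟩ : ∃ e : ℤ, ε = e := by
      rcases hε with rfl | rfl
      · exact ⟨1, by simp⟩
      · exact ⟨-1, by simp⟩
    obtain ⟨q, -⟩ := hM.nonempty
    have hfar : ∀ k, ∃ N : ℕ, ∀ n : ℕ, N ≤ n → G k (shift (e * n : ℤ) q) ∈ Side e M := by
      intro k
      obtain ⟨N, hN⟩ := (hM.bddToward e).exists_forall_shift_mem_side hε0 (G k q)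
      refine ⟨N, fun n hn => ?_⟩
      have hpow : (1 : ℝ) ≤ d ^ (2 * k) := by
        rw [pow_mul, ← sq_abs]
        exact one_le_pow₀ (one_le_pow₀ hd1.le)
      have := hN (d ^ (2 * k) * n) (by
        have : (N : ℝ) ≤ n := by exact_mod_cast hn
        nlinarith [(Nat.cast_nonneg n : (0 : ℝ) ≤ n)])
      simp only [G, Homeomorph.trans_apply] at this ⊢
      rw [hF.pow, shift_shift]
      rw [shift_shift] at this
      convert this using 2
      push_cast; ring_nf
    obtain ⟨N₁, hN₁⟩ := hfar k
    obtain ⟨N₂, hN₂⟩ := hfar (Order.succ k)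
    exact ⟨_, hN₁ _ (le_max_left N₁ N₂), hN₂ _ (le_max_right N₁ N₂)⟩

/-- A cut that is disjoint from the nontrivial translates of its image yields a function on the
strip that is multiplied by `d`. -/
theorem IsCut.exists_expanding (hM : IsCut M) (hF : IsEquivariant F d) (hd : 1 < |d|)
    (hFM : ∀ p ∈ M, ∀ n : ℤ, shift n (F p) ∈ M → n = 0) :
    ∃ H : C(Strip, ℝ), (∀ p, H (F p) = d * H p) ∧ (∀ p (n : ℤ), H (shift n p) = H p + n) ∧
      IsPreconnected {p | 0 < H p} ∧ IsPreconnected {p | H p < 0} := by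
  have hd0 : d ≠ 0 := by rintro rfl; norm_num at hd
  have hd1 : (1 : ℝ) < |(d : ℝ)| := by exact_mod_cast hd
  obtain ⟨φ, c, hφF, hφ, hsh, hlo, hup, hlo', hup'⟩ := hM.exists_level_map hF hd0 hFM
  obtain ⟨H, hH, C, hC⟩ := exists_continuousMap_comp_eq_mul F.continuous hd1 hφF hφ
  have hHk : ∀ k p, H ((F ^ k) p) = d ^ k * H p := by
    intro k
    induction k with
    | zero => simp
    | succ k ih =>
      intro p
      rw [pow_succ', Homeomorph.mul_apply, hH, ih, pow_succ']; ring
  obtain ⟨n₀, hn₀⟩ := exists_nat_gt C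
  refine ⟨H, hH, fun p n => ?_, ?_, ?_⟩
  · by_contra hne
    -- The defect of equivariance is bounded by `2 * C`, yet `F ^ k` multiplies it by `d ^ k`; hence
    -- it vanishes.
    have hb : ∀ q (m : ℤ), |H (shift m q) - H q - m| ≤ 2 * C := by
      intro q m
      have g1 := abs_le.1 (hC q)
      have g2 := abs_le.1 (hC (shift m q))
      rw [hsh] at g2
      push_cast at g2
      rw [abs_le]
      constructor <;> linarith
    have hpos : 0 < |H (shift n p) - H p - n| := abs_pos.2 fun h => hne (by linarith)
    obtain ⟨k, hk⟩ := pow_unbounded_of_one_lt (2 * C / |H (shift n p) - H p - n|) hd1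
    rw [div_lt_iff₀ hpos, ← abs_pow, ← abs_mul] at hk
    have := hb ((F ^ k) p) (d ^ k * n)
    rw [← hF.pow, hHk, hHk] at this
    push_cast at this
    rw [← mul_sub, ← mul_sub] at this
    linarith
  · have := isPreconnected_of_expanding (H := H) (r := -(n₀ : ℤ)) (C := n₀ + 1 + C)
      (Or.inl rfl) hM hF hd hH (fun p hp => ?_) (fun p hp => ?_)
    · simpa using this
    · have h1 := hup p _ hp
      have h2 : (n₀ : ℝ) < φ p := by exact_mod_cast h1
      have := (abs_le.1 (hC p)).1
      linarith
    · refine hup' p _ ?_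
      have := (abs_le.1 (hC p)).2
      have h2 : (n₀ : ℝ) + 1 < φ p := by linarith
      exact_mod_cast h2
  · have := isPreconnected_of_expanding (H := H) (r := -(-(n₀ + 1) : ℤ)) (C := n₀ + 1 + C)
      (Or.inr rfl) hM hF hd hH (fun p hp => ?_) (fun p hp => ?_)
    · simpa using this
    · have h1 := hlo p _ (by exact_mod_cast hp)
      have h2 : (φ p : ℝ) ≤ -(n₀ + 1) := by exact_mod_cast h1
      have := (abs_le.1 (hC p)).2
      linarith
    · have := hlo' p (-(n₀ + 1)) ?_
      · exact_mod_cast this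
      have := (abs_le.1 (hC p)).1
      have h2 : (φ p : ℝ) < -(n₀ + 1) := by linarith
      exact_mod_cast h2

end Dynamics

end Cut

/-! ### The covering of the annulus and lifts of maps and loops -/

/-- The universal covering of the open annulus. -/
noncomputable def proj : C(Strip, OpenAnnulus) :=
  ⟨fun p => (p.1, turn p.2), continuous_fst.prodMk (continuous_turn.comp continuous_snd)⟩

@[simp] theorem proj_fst (p : Strip) : (proj p).1 = p.1 := rfl

@[simp] theorem proj_snd (p : Strip) : (proj p).2 = turn p.2 := rfl

theorem proj_eq_proj {p q : Strip} : proj p = proj q ↔ ∃ n : ℤ, p = shift n q := by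
  constructor
  · intro h
    obtain ⟨n, hn⟩ := turn_eq_turn.1 (congrArg Prod.snd h)
    exact ⟨n, Prod.ext (congrArg (fun a : OpenAnnulus => a.1) h) hn⟩
  · rintro ⟨n, rfl⟩
    exact Prod.ext rfl (turn_add_int _ _)

@[simp] theorem proj_shift_int (n : ℤ) (p : Strip) : proj (shift n p) = proj p :=
  proj_eq_proj.2 ⟨n, rfl⟩

theorem proj_surjective : Function.Surjective proj := by
  rintro ⟨x, z⟩
  obtain ⟨t, rfl⟩ := turn_surjective z
  exact ⟨(x, t), rfl⟩

theorem isOpenMap_proj : IsOpenMap proj :=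
  IsOpenMap.id.prodMap isCoveringMap_turn.isLocalHomeomorph.isOpenMap

theorem isQuotientMap_proj : Topology.IsQuotientMap proj :=
  isOpenMap_proj.isQuotientMap proj.continuous proj_surjective

/-- Lifts to the strip of a map on a connected space agree if they agree at one point. -/
theorem eq_of_proj_comp_eq {X : Type*} [TopologicalSpace X] [PreconnectedSpace X] {u v : X → Strip}
    (hu : Continuous u) (hv : Continuous v) (h : ∀ x, proj (u x) = proj (v x)) {a : X}
    (ha : u a = v a) : u = v := by
  obtain ⟨n, hn⟩ := isPreconnected_univ.exists_int_forall_abs_sub_le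
    (ψ := fun x => (u x).2 - (v x).2) (c := 0) (by fun_prop) (by norm_num) (fun x _ => by
      obtain ⟨n, hn⟩ := proj_eq_proj.1 (h x)
      exact ⟨n, by simp [hn]⟩)
  have hn' : ∀ x, (u x).2 - (v x).2 = n := fun x =>
    sub_eq_zero.1 (abs_nonpos_iff.1 (hn x trivial))
  funext x
  refine Prod.ext (congrArg (fun a : OpenAnnulus => a.1) (h x)) ?_
  have h1 := hn' a
  rw [ha, sub_self] at h1
  have h2 := hn' x
  linarith

theorem exists_lift_proj {X : Type*} [TopologicalSpace X] [SimplyConnectedSpace X]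
    [LocallyPathConnectedSpace X] (g : C(X, OpenAnnulus)) (a : X) (p : Strip)
    (hp : proj p = g a) : ∃ G : C(X, Strip), G a = p ∧ ∀ x, proj (G x) = g x := by
  obtain ⟨θ, hθ⟩ := exists_turn_lift ⟨fun x => (g x).2, by fun_prop⟩
  let G : C(X, Strip) := ⟨fun x => ((g x).1, θ x), by fun_prop⟩
  have hG : ∀ x, proj (G x) = g x := fun x => Prod.ext rfl (hθ x)
  obtain ⟨n, hn⟩ := proj_eq_proj.1 (hp.trans (hG a).symm)
  refine ⟨⟨fun x => shift n (G x), by fun_prop⟩, hn.symm, fun x => ?_⟩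
  exact (proj_shift_int n _).trans (hG x)

theorem LoopClass.eq_of_lift {z : Circle} {γ : Path z z} {n : ℤ} (h : LoopClass γ n)
    {θ : unitInterval → ℝ} (hθ : Continuous θ) (hγ : ∀ t, turn (θ t) = γ t) :
    θ 1 - θ 0 = n := by
  obtain ⟨α, hα, hn⟩ := h
  have hp : (2 * Real.pi) ≠ 0 := by positivity
  have : PreconnectedSpace unitInterval :=
    isPreconnected_iff_preconnectedSpace.1 isPreconnected_Icc
  obtain ⟨m, hm⟩ := isPreconnected_univ.exists_int_forall_abs_sub_le
    (ψ := fun x => θ x - α x / (2 * Real.pi)) (c := 0) (by fun_prop) (by norm_num)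
    (fun x _ => by
      have : turn (θ x) = turn (α x / (2 * Real.pi)) := by
        rw [hγ, ← hα, turn, mul_div_cancel₀ _ hp]
      obtain ⟨n, hn⟩ := turn_eq_turn.1 this
      exact ⟨n, by simp [hn]⟩)
  have h0 := sub_eq_zero.1 (abs_nonpos_iff.1 (hm 0 trivial))
  have h1 := sub_eq_zero.1 (abs_nonpos_iff.1 (hm 1 trivial))
  have h2 : α 1 / (2 * Real.pi) - α 0 / (2 * Real.pi) = n := by
    rw [← sub_div, hn, mul_div_cancel_left₀ _ hp]
  linarith

theorem loopClass_of_lift {z : Circle} {γ : Path z z} {n : ℤ} {θ : unitInterval → ℝ}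
    (hθ : Continuous θ) (hγ : ∀ t, turn (θ t) = γ t) (hn : θ 1 - θ 0 = n) : LoopClass γ n :=
  ⟨⟨fun t => 2 * Real.pi * θ t, by fun_prop⟩, hγ, by simp [← mul_sub, hn]⟩

theorem annulusLoopClass_of_lift {a : OpenAnnulus} {γ : Path a a} {n : ℤ} {p : Strip}
    (Γ : Path p (shift n p)) (h : ∀ t, proj (Γ t) = γ t) : AnnulusLoopClass γ n :=
  loopClass_of_lift (θ := fun t => (Γ t).2) (by fun_prop) (fun t => congrArg Prod.snd (h t))
    (by simp)

theorem AnnulusLoopClass.exists_lift {a : OpenAnnulus} {γ : Path a a} {n : ℤ}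
    (h : AnnulusLoopClass γ n) {p : Strip} (hp : proj p = a) :
    ∃ Γ : Path p (shift n p), ∀ t, proj (Γ t) = γ t := by
  have hp2 : γ 0 = proj p := γ.source.trans hp.symm
  obtain ⟨θ, hθ, hθ0⟩ := isCoveringMap_turn.exists_path_lifts
    (⟨fun t => (γ t).2, by fun_prop⟩ : C(unitInterval, Circle)) p.2 (congrArg Prod.snd hp2)
  have hθ' : ∀ t, turn (θ t) = (γ t).2 := congr_fun hθ
  have hn := LoopClass.eq_of_lift h θ.continuous hθ'
  refine ⟨⟨⟨fun t => ((γ t).1, θ t), by fun_prop⟩, ?_, ?_⟩, fun t => Prod.ext rfl (hθ' t)⟩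
  · exact Prod.ext (congrArg (fun a : OpenAnnulus => a.1) hp2) hθ0
  · refine Prod.ext ?_ ?_
    · have h01 : γ 1 = proj p := γ.target.trans hp.symm
      exact congrArg (fun a : OpenAnnulus => a.1) h01
    · change θ 1 = p.2 + n
      rw [← hn, ← hθ0]; ring

/-- The loop in the annulus below a path in the strip that joins a point to a translate. -/
noncomputable def projLoop {p : Strip} {n : ℤ} (Γ : Path p (shift n p)) : Path (proj p) (proj p) :=
  (Γ.map proj.continuous).cast rfl (proj_shift_int n p).symm

theorem annulusLoopClass_projLoop {p : Strip} {n : ℤ} (Γ : Path p (shift n p)) :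
    AnnulusLoopClass (projLoop Γ) n :=
  annulusLoopClass_of_lift Γ fun _ => rfl

section Circle

theorem exists_lift_circle (h : C(OpenAnnulus, Circle)) :
    ∃ H : C(Strip, ℝ), ∀ p, turn (H p) = h (proj p) :=
  exists_turn_lift (h.comp proj)

theorem InducesIso.exists_unit {h : C(OpenAnnulus, Circle)} (hh : InducesIso h) {H : C(Strip, ℝ)}
    (hH : ∀ p, turn (H p) = h (proj p)) :
    ∃ e : ℤ, (e = 1 ∨ e = -1) ∧ ∀ p (n : ℤ), H (shift n p) = H p + e * n := by
  obtain ⟨e, he⟩ := hh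
  have hlin : ∀ n, e n = e 1 * n := fun n => by
    have := map_zsmul e n 1
    simpa [mul_comm] using this
  refine ⟨e 1, ?_, fun p n => ?_⟩
  · obtain ⟨m, hm⟩ := e.surjective 1
    rw [hlin] at hm
    exact Int.isUnit_iff.1 (IsUnit.of_mul_eq_one m hm)
  · let Γ : Path p (shift n p) := PathConnectedSpace.somePath _ _
    have := (he _ _ n (annulusLoopClass_projLoop Γ)).eq_of_lift (θ := fun t => H (Γ t))
      (by fun_prop) (fun t => hH _)
    rw [hlin] at this
    push_cast at this
    rw [← this]
    simp

theorem inducesIso_of_lift {h : C(OpenAnnulus, Circle)} {H : C(Strip, ℝ)}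
    (hH : ∀ p, turn (H p) = h (proj p)) (hs : ∀ p (n : ℤ), H (shift n p) = H p + n) :
    InducesIso h := by
  refine ⟨AddEquiv.refl _, fun a γ n hγ => ?_⟩
  obtain ⟨p, hp⟩ := proj_surjective a
  obtain ⟨Γ, hΓ⟩ := hγ.exists_lift hp
  refine loopClass_of_lift (θ := fun t => H (Γ t)) (by fun_prop) (fun t => ?_) ?_
  · rw [hH, hΓ]; rfl
  · simp [hs]

end Circle

section Annulus

variable {f : C(OpenAnnulus, OpenAnnulus)} {d : ℤ}

/-- A covering map of the annulus of degree `d` lifts to an equivariant homeomorphism of the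
strip. -/
theorem HasDegree.exists_lift (hdeg : HasDegree f d) (hf : IsCoveringMap f) :
    ∃ F : Strip ≃ₜ Strip, IsEquivariant F d ∧ ∀ p, proj (F p) = f (proj p) := by
  let p₀ : Strip := (⟨1 / 2, by norm_num, by norm_num⟩, 0)
  obtain ⟨q₀, hq₀⟩ := proj_surjective (f (proj p₀))
  obtain ⟨F, hF₀, hF⟩ := exists_lift_proj (f.comp proj) p₀ q₀ hq₀
  -- The inverse of `F`: lift `proj` first through the covering `f`, then through `proj`. Uniqueness
  -- of lifts makes both composites the identity.
  obtain ⟨g, ⟨hg₀, hg⟩, -⟩ := hf.existsUnique_continuousMap_lifts proj q₀ (proj p₀) hq₀.symm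
  obtain ⟨G, hG₀, hG⟩ := exists_lift_proj g q₀ p₀ hg₀.symm
  have hFG : (fun p => F (G p)) = id := by
    refine eq_of_proj_comp_eq (a := q₀) (by fun_prop) continuous_id (fun x => ?_) (by
      simp [hG₀, hF₀])
    rw [hF, ContinuousMap.comp_apply, hG]
    exact congr_fun hg x
  have hGF' : (fun p => proj (G (F p))) = proj := by
    refine hf.eq_of_comp_eq (by fun_prop) proj.continuous ?_ p₀ (by simp [hF₀, hG₀])
    funext x
    have h1 := hF (G (F x))
    have h2 := congr_fun hFG (F x)
    simp only [id] at h2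
    rw [h2, hF] at h1
    exact h1.symm
  have hGF : (fun p => G (F p)) = id :=
    eq_of_proj_comp_eq (a := p₀) (by fun_prop) continuous_id (fun x => congr_fun hGF' x) (by
      simp [hF₀, hG₀])
  refine ⟨⟨⟨F, G, congr_fun hGF, congr_fun hFG⟩, F.continuous, G.continuous⟩, fun p n => ?_, hF⟩
  change F (shift n p) = shift (d * n : ℤ) (F p)
  let Γ : Path p (shift n p) := PathConnectedSpace.somePath _ _
  have h1 := LoopClass.eq_of_lift (hdeg _ _ _ (annulusLoopClass_projLoop Γ))
    (θ := fun t => (F (Γ t)).2) (by fun_prop) (fun t => congrArg Prod.snd (hF _))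
  refine Prod.ext ?_ ?_
  · have e1 := congrArg Prod.fst (hF (shift n p))
    have e2 := congrArg Prod.fst (hF p)
    rw [ContinuousMap.comp_apply, proj_shift_int] at e1
    exact e1.trans e2.symm
  · simp only [Path.source, Path.target] at h1
    rw [shift_snd, ← h1]; ring

end Annulus

/-! ### Cuts in the levels of a height -/

section Height

variable {H : C(Strip, ℝ)}

/-- The function `H p - p.2` is invariant under integral translations, so a compact box bounds it.
-/
theorem exists_abs_height_sub_le (hs : ∀ p (n : ℤ), H (shift n p) = H p + n)
    (a b : Ioo (0 : ℝ) 1) : ∃ B : ℝ, ∀ p : Strip, a ≤ p.1 → p.1 ≤ b → |H p - p.2| ≤ B := by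
  have hK : IsCompact (Icc a b ×ˢ Icc (0 : ℝ) 1) := (isCompact_Icc_unit a b).prod isCompact_Icc
  obtain ⟨B, hB⟩ := hK.exists_bound_of_continuousOn (f := fun p : Strip => H p - p.2)
    (by fun_prop)
  refine ⟨B, fun p h1 h2 => ?_⟩
  have := hB (shift (-⌊p.2⌋ : ℤ) p) ⟨⟨h1, h2⟩, by
    rw [shift_snd]
    have g1 := Int.floor_le p.2
    have g2 := (Int.lt_floor_add_one p.2).le
    push_cast
    constructor <;> linarith⟩
  rw [hs, shift_snd, Real.norm_eq_abs] at this
  convert this using 2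
  ring

theorem isCut_of_subset_level (hs : ∀ p (n : ℤ), H (shift n p) = H p + n) {M : Set Strip} {c : ℝ}
    (hc : IsClosed M) (hp : IsPreconnected M) (hx : ∀ x, ∃ t, (x, t) ∈ M)
    (hM : ∀ p ∈ M, H p = c) : IsCut M := by
  refine ⟨hc, hp, hx, fun a b => ?_, fun p hp n hn => ?_⟩
  · obtain ⟨B, hB⟩ := exists_abs_height_sub_le hs a b
    refine ⟨B + |c|, fun p hp h1 h2 => ?_⟩
    have g := hB p h1 h2
    rw [hM p hp, abs_sub_comm] at g
    have := abs_add_le (p.2 - c) c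
    rw [sub_add_cancel] at this
    linarith
  · have h1 := hM _ hn
    rw [hs, hM p hp] at h1
    exact_mod_cast (by linarith : (n : ℝ) = 0)

theorem bddToward_sublevel (hs : ∀ p (n : ℤ), H (shift n p) = H p + n) {ε : ℝ}
    (hε : ε = 1 ∨ ε = -1) (c : ℝ) : BddToward ε {p | ε * (H p - c) ≤ 0} := by
  intro a b
  obtain ⟨B, hB⟩ := exists_abs_height_sub_le hs a b
  refine ⟨B + |c|, fun p hp h1 h2 => ?_⟩
  have g := abs_le.1 (hB p h1 h2)
  have g1 := le_abs_self c
  have g2 := neg_abs_le c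
  rcases hε with rfl | rfl <;> · simp only [mem_ofPred_eq] at hp; linarith

theorem pos_of_mem_side_sublevel {ε c : ℝ} {p : Strip}
    (hp : p ∈ Side ε {p | ε * (H p - c) ≤ 0}) : 0 < ε * (H p - c) :=
  not_le.1 (notMem_of_mem_side hp)

theorem isClosed_sublevel (ε c : ℝ) : IsClosed {p | ε * (H p - c) ≤ 0} :=
  isClosed_le (by fun_prop) continuous_const

theorem image_side_sublevel (hs : ∀ p (n : ℤ), H (shift n p) = H p + n) {ε : ℝ}
    (hε : ε = 1 ∨ ε = -1) {F : Strip ≃ₜ Strip} {d : ℤ} (hF : IsEquivariant F d) (hd : 0 < d)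
    (hH : ∀ p, H (F p) = d * H p) :
    F '' Side ε {p | ε * (H p - 0) ≤ 0} = Side ε {p | ε * (H p - 0) ≤ 0} := by
  have hε0 : ε ≠ 0 := by rcases hε with rfl | rfl <;> norm_num
  have hb := bddToward_sublevel hs hε 0
  have hd' : (1 : ℝ) ≤ d := by exact_mod_cast hd
  obtain ⟨e, rfl⟩ : ∃ e : ℤ, ε = e := by
    rcases hε with rfl | rfl
    · exact ⟨1, by simp⟩
    · exact ⟨-1, by simp⟩
  have hsh : ∀ (p : Strip) (n : ℕ),
      F (shift (e * n : ℝ) p) = shift (e * (d * n) : ℝ) (F p) := by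
    intro p n
    have := hF p (e * n)
    push_cast at this
    rw [this]; ring_nf
  obtain ⟨q⟩ : Nonempty Strip := inferInstance
  refine Subset.antisymm ?_ ?_
  · refine hb.subset_side hε0 ((hb.isPreconnected_side hε0).image F F.continuous.continuousOn)
      ?_ (F q) fun N => ?_
    · rintro _ ⟨p, hp, rfl⟩
      have := pos_of_mem_side_sublevel hp
      rw [mem_ofPred_eq, not_le, hH]
      have h2 : (e : ℝ) * (d * H p - 0) = d * (e * (H p - 0)) := by ring
      rw [h2]
      positivity
    · obtain ⟨K, hK⟩ := hb.exists_forall_shift_mem_side hε0 q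
      refine ⟨d * (max K N : ℕ), ?_, shift (e * (max K N : ℕ)) q, hK _ ?_, hsh _ _⟩
      · have : (N : ℝ) ≤ (max K N : ℕ) := by exact_mod_cast le_max_right K N
        nlinarith [(Nat.cast_nonneg N : (0 : ℝ) ≤ N)]
      · exact_mod_cast le_max_left K N
  · intro z hz
    refine ⟨F.symm z, ?_, F.apply_symm_apply z⟩
    refine hb.subset_side hε0 ((hb.isPreconnected_side hε0).image F.symm
      F.symm.continuous.continuousOn) ?_ q (fun N => ?_) ⟨z, hz, rfl⟩
    · rintro _ ⟨p, hp, rfl⟩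
      have := pos_of_mem_side_sublevel hp
      rw [← F.apply_symm_apply p, hH] at this
      rw [mem_ofPred_eq, not_le]
      have h2 : (e : ℝ) * (d * H (F.symm p) - 0) = d * (e * (H (F.symm p) - 0)) := by ring
      rw [h2] at this
      exact pos_of_mul_pos_right this (by positivity)
    · obtain ⟨K, hK⟩ := hb.exists_forall_shift_mem_side hε0 (F q)
      have h1 : (N : ℝ) ≤ (max K N : ℕ) := by exact_mod_cast le_max_right K N
      have h2 : (K : ℝ) ≤ (max K N : ℕ) := by exact_mod_cast le_max_left K N
      refine ⟨(max K N : ℕ), h1, F (shift (e * (max K N : ℕ) : ℝ) q), ?_, F.symm_apply_apply _⟩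
      rw [hsh]
      exact hK _ (by nlinarith [(Nat.cast_nonneg K : (0 : ℝ) ≤ K)])

/-- Every level of a height function contains a cut. -/
theorem exists_isCut_subset_level (hs : ∀ p (n : ℤ), H (shift n p) = H p + n) (c : ℝ) :
    ∃ M, IsCut M ∧ (∀ p ∈ M, H p = c) ∧ (c = 0 → ∀ (F : Strip ≃ₜ Strip) (d : ℤ), 0 < d →
      IsEquivariant F d → (∀ p, H (F p) = d * H p) → F '' M = M) := by
  have h1 : ((1 : ℝ) = 1 ∨ (1 : ℝ) = -1) := Or.inl rfl
  have h2 : ((-1 : ℝ) = 1 ∨ (-1 : ℝ) = -1) := Or.inr rfl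
  have hb₁ := bddToward_sublevel hs h1 c
  have hb₂ := bddToward_sublevel hs h2 c
  -- The whole set {H > c} may be disconnected, whereas its part `W` joined to the upper end is
  -- connected, as unicoherence requires.
  set W := Side 1 {p | 1 * (H p - c) ≤ 0}
  set W' := Side (-1) {p | -1 * (H p - c) ≤ 0}
  have hW : IsPreconnected W := hb₁.isPreconnected_side (by norm_num)
  have hW' : IsPreconnected W' := hb₂.isPreconnected_side (by norm_num)
  have hWo : IsOpen W := isOpen_side (isClosed_sublevel 1 c)
  have hWp : ∀ p ∈ W, c < H p := fun p hp => by
    have := pos_of_mem_side_sublevel hp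
    linarith
  have hWp' : ∀ p ∈ W', H p < c := fun p hp => by
    have := pos_of_mem_side_sublevel hp
    linarith
  have hWW : W' ⊆ Wᶜ := fun p hp hp' => (hWp p hp').not_gt (hWp' p hp)
  have far₁ : ∀ p : Strip, ∃ t, (p.1, t) ∈ W := fun p => by
    obtain ⟨N, hN⟩ := hb₁.exists_forall_shift_mem_side (by norm_num) p
    exact ⟨_, hN N le_rfl⟩
  have far₂ : ∀ p : Strip, ∃ t, (p.1, t) ∈ W' := fun p => by
    obtain ⟨N, hN⟩ := hb₂.exists_forall_shift_mem_side (by norm_num) p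
    exact ⟨_, hN N le_rfl⟩
  obtain ⟨q₀⟩ : Nonempty Strip := inferInstance
  obtain ⟨t, hq⟩ := far₂ q₀
  obtain ⟨t', hw⟩ := far₁ q₀
  set q : Strip := (q₀.1, t)
  set Q := connectedComponentIn Wᶜ q with hQ
  have hQc : IsClosed Q := hWo.isClosed_compl.isClosed_connectedComponentIn q
  have hWQ : W' ⊆ Q := hW'.subset_connectedComponentIn hq hWW
  -- By local connectedness a frontier point of `Q` is in the closure of `W`, whence `H ≥ c`. If `H
  -- > c` there, its component in {H > c} would meet `W`, and the point would belong to `W`.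
  have hlev : ∀ p ∈ frontier Q, H p = c := by
    intro z hz
    have hzQ : z ∈ Q := hQc.frontier_subset hz
    have hzW : z ∈ Wᶜ := connectedComponentIn_subset _ _ hzQ
    have hzc : z ∈ closure W := by
      by_contra hzc
      refine hz.2 (subset_interior_connectedComponentIn q ⟨hzQ, ?_⟩)
      rwa [interior_compl]
    refine le_antisymm ?_ ?_
    · by_contra! hlt
      have hzm : z ∈ {p | 1 * (H p - c) ≤ 0}ᶜ := by
        rw [mem_compl_iff, mem_ofPred_eq]; linarith
      obtain ⟨y, hy, hyW⟩ := mem_closure_iff.1 hzc _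
        (isClosed_sublevel 1 c).isOpen_compl.connectedComponentIn (mem_connectedComponentIn hzm)
      exact hzW (isPreconnected_connectedComponentIn.subset_side
        (connectedComponentIn_subset _ _) hy hyW (mem_connectedComponentIn hzm))
    · by_contra! hlt
      obtain ⟨y, hy, hyW⟩ := mem_closure_iff.1 hzc {p | H p < c}
        (isOpen_lt H.continuous continuous_const) hlt
      exact (hWp y hyW).not_gt hy
  refine ⟨frontier Q, isCut_of_subset_level hs isClosed_frontier
    (isPreconnected_frontier_connectedComponentIn_compl hW hWo ⟨_, hw⟩ q) (fun x => ?_) hlev,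
    hlev, ?_⟩
  · obtain ⟨t₁, h₁⟩ := far₁ (x, 0)
    obtain ⟨t₂, h₂⟩ := far₂ (x, 0)
    have hl : Continuous fun t : ℝ => ((x, t) : Strip) := by fun_prop
    -- Each vertical line meets `Q` far down and leaves it far up, so it has a frontier point of `Q`
    -- in between.
    obtain ⟨t, ht⟩ := nonempty_frontier_iff (s := (fun t : ℝ => ((x, t) : Strip)) ⁻¹' Q) |>.2
      ⟨⟨t₂, hWQ h₂⟩, fun huniv => connectedComponentIn_subset _ _
        (huniv ▸ mem_univ t₁ : t₁ ∈ (fun t : ℝ => ((x, t) : Strip)) ⁻¹' Q) h₁⟩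
    exact ⟨t, hl.frontier_preimage_subset Q ht⟩
  · rintro rfl F d hd hF hH
    have e1 : F '' W = W := image_side_sublevel hs h1 hF hd hH
    have e2 : F '' W' = W' := image_side_sublevel hs h2 hF hd hH
    rw [F.image_frontier, hQ, F.image_connectedComponentIn (hWW hq), F.image_compl, e1]
    have : F q ∈ Q := hWQ (e2 ▸ mem_image_of_mem F hq)
    rw [← connectedComponentIn_eq this]

/-- The translates of `M` lie on the levels `c + n`, hence form a locally finite family. -/
theorem isClosed_image_proj (hs : ∀ p (n : ℤ), H (shift n p) = H p + n) {M : Set Strip} {c : ℝ}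
    (hc : IsClosed M) (hM : ∀ p ∈ M, H p = c) : IsClosed (proj '' M) := by
  rw [← isQuotientMap_proj.isClosed_preimage]
  have hu : proj ⁻¹' (proj '' M) = ⋃ n : ℤ, shift n '' M := by
    ext p
    simp only [mem_preimage, mem_image, mem_iUnion]
    constructor
    · rintro ⟨q, hq, h⟩
      obtain ⟨n, rfl⟩ := proj_eq_proj.1 h.symm
      exact ⟨n, q, hq, rfl⟩
    · rintro ⟨n, q, hq, rfl⟩
      exact ⟨q, hq, (proj_shift_int n q).symm⟩
  rw [hu]
  refine LocallyFinite.isClosed_iUnion (fun p => ?_) fun n =>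
    (shift n).isClosedMap _ hc
  refine ⟨{q | |H q - H p| < 1 / 2}, (isOpen_lt (by fun_prop) continuous_const).mem_nhds
    (by simp), Set.Subsingleton.finite ?_⟩
  rintro m ⟨_, ⟨q, hq, rfl⟩, h1⟩ n ⟨_, ⟨r, hr, rfl⟩, h2⟩
  simp only [mem_ofPred_eq] at h1 h2
  rw [hs, hM q hq, abs_lt] at h1
  rw [hs, hM r hr, abs_lt] at h2
  have g1 : (m : ℝ) - n < 1 := by linarith
  have g2 : (-1 : ℝ) < m - n := by linarith
  have g1' : m - n < 1 := by exact_mod_cast g1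
  have g2' : -1 < m - n := by exact_mod_cast g2
  omega

theorem isConnector_image_proj (hs : ∀ p (n : ℤ), H (shift n p) = H p + n) {M : Set Strip} {c : ℝ}
    (hM : IsCut M) (hMc : ∀ p ∈ M, H p = c) : IsConnector (proj '' M) := by
  refine ⟨⟨hM.nonempty.image _, hM.isPreconnected.image _ proj.continuous.continuousOn⟩,
    isClosed_image_proj hs hM.isClosed hMc, fun r hr => ⟨?_, ?_⟩⟩
  · have h1 : 0 < min (r / 2) (1 / 2) := by positivity
    obtain ⟨t, ht⟩ := hM.exists_mem ⟨min (r / 2) (1 / 2), h1,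
      (min_le_right _ _).trans_lt (by norm_num)⟩
    exact ⟨_, ⟨_, ht, rfl⟩, (min_le_left _ _).trans_lt (by linarith)⟩
  · have h1 : 0 < min (r / 2) (1 / 2) := by positivity
    obtain ⟨t, ht⟩ := hM.exists_mem ⟨1 - min (r / 2) (1 / 2), by
      have := min_le_right (r / 2) (1 / 2); linarith, by linarith⟩
    refine ⟨_, ⟨_, ht, rfl⟩, ?_⟩
    have := min_le_left (r / 2) (1 / 2)
    change 1 - r < 1 - min (r / 2) (1 / 2)
    linarith

end Height

/-- Take the complement of the antipodal fibre as neighbourhood. Along a loop of class `n ≠ 0` the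
lift of `h` sweeps an interval of length `|e * n| ≥ 1`, which meets `c + 1 / 2 + ℤ`. -/
theorem not_isEssential_of_subset_fiber {h : C(OpenAnnulus, Circle)} {H : C(Strip, ℝ)} {e : ℤ}
    (he : e ≠ 0) (hH : ∀ p, turn (H p) = h (proj p))
    (hs : ∀ p (n : ℤ), H (shift n p) = H p + e * n) {C : Set OpenAnnulus} {z : Circle}
    (hC : C ⊆ h ⁻¹' {z}) : ¬ IsEssential C := by
  intro hess
  obtain ⟨c, rfl⟩ := turn_surjective z
  have hne : turn c ≠ turn (c + 1 / 2) := by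
    intro heq
    obtain ⟨n, hn⟩ := turn_eq_turn.1 heq
    have h1 : (2 * n + 1 : ℝ) = 0 := by linarith
    have h2 : 2 * n + 1 = 0 := by exact_mod_cast h1
    omega
  have := hess (h ⁻¹' {turn (c + 1 / 2)}ᶜ) (isOpen_compl_singleton.preimage h.continuous)
    fun a ha => by
      rw [mem_preimage, mem_compl_singleton_iff, hC ha]
      exact hne
  have hle : AddSubgroup.closure {n : ℤ | ∃ (a : OpenAnnulus) (γ : Path a a),
      (∀ t, γ t ∈ h ⁻¹' {turn (c + 1 / 2)}ᶜ) ∧ AnnulusLoopClass γ n} ≤ ⊥ := by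
    rw [AddSubgroup.closure_le]
    rintro n ⟨a, γ, hγ, hn⟩
    by_contra hn0
    obtain ⟨p, hp⟩ := proj_surjective a
    obtain ⟨Γ, hΓ⟩ := hn.exists_lift hp
    have : PreconnectedSpace unitInterval :=
      isPreconnected_iff_preconnectedSpace.1 isPreconnected_Icc
    have hiv : uIcc (H p) (H p + e * n) ⊆ range fun t => H (Γ t) := by
      have hΓc : Continuous fun t => H (Γ t) := by fun_prop
      have := intermediate_value_univ 0 1 hΓc
      have := intermediate_value_univ 1 0 hΓc
      simp only [Path.source, Path.target, hs] at *
      rcases le_total (H p) (H p + e * n) with hle | hle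
      · rwa [uIcc_of_le hle]
      · rwa [uIcc_of_ge hle]
    have hmem : ∃ m : ℤ, c + 1 / 2 + m ∈ uIcc (H p) (H p + e * n) := by
      have hen : e * n ≠ 0 := mul_ne_zero he hn0
      rcases lt_or_gt_of_ne hen with hlt | hgt
      · refine ⟨⌊H p - c - 1 / 2⌋, mem_uIcc.2 (Or.inr ?_)⟩
        have g1 := Int.floor_le (H p - c - 1 / 2)
        have g2 := Int.lt_floor_add_one (H p - c - 1 / 2)
        have g3 : ((e * n : ℤ) : ℝ) ≤ -1 := by exact_mod_cast Int.le_sub_one_of_lt hlt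
        push_cast at g3
        constructor <;> linarith
      · refine ⟨⌈H p - c - 1 / 2⌉, mem_uIcc.2 (Or.inl ?_)⟩
        have g1 := Int.le_ceil (H p - c - 1 / 2)
        have g2 := Int.ceil_lt_add_one (H p - c - 1 / 2)
        have g3 : (1 : ℝ) ≤ ((e * n : ℤ) : ℝ) := by exact_mod_cast hgt
        push_cast at g3
        constructor <;> linarith
    obtain ⟨m, hm⟩ := hmem
    obtain ⟨t, ht⟩ := hiv hm
    refine hγ t ?_
    rw [mem_singleton_iff, ← hΓ, ← hH]
    exact turn_eq_turn.2 ⟨m, ht⟩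
  rw [this] at hle
  have h1 : (1 : ℤ) ∈ (⊥ : AddSubgroup ℤ) := hle trivial
  simp at h1

/-! ### From semiconjugacies to invariant connectors -/

section Semiconjugacy

variable {f : C(OpenAnnulus, OpenAnnulus)} {d : ℤ}

theorem exists_descend {H : C(Strip, ℝ)} (hs : ∀ p (n : ℤ), H (shift n p) = H p + n) :
    ∃ h : C(OpenAnnulus, Circle), ∀ p, turn (H p) = h (proj p) := by
  let g : C(Strip, Circle) := ⟨fun p => turn (H p), continuous_turn.comp H.continuous⟩
  have hg : Function.FactorsThrough g proj := by
    intro p q hpq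
    obtain ⟨n, rfl⟩ := proj_eq_proj.1 hpq
    change turn _ = turn _
    rw [hs, turn_add_int]
  exact ⟨isQuotientMap_proj.lift g hg, fun p =>
    (DFunLike.congr_fun (isQuotientMap_proj.lift_comp g hg) p).symm⟩

theorem IsEquivariant.trans_shift {F : Strip ≃ₜ Strip} (hF : IsEquivariant F d) (r : ℝ) :
    IsEquivariant (F.trans (shift r)) d := by
  intro p n
  simp only [Homeomorph.trans_apply]
  rw [hF, shift_shift, shift_shift, add_comm]

/-- For any lifts, `H ∘ F - d * H` is a constant integer `k`. Multiplying `H` by its sign `e` and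
composing `F` with the deck translation by `-(e * k)` removes both. -/
theorem IsSemiconjugacy.exists_lift {h : C(OpenAnnulus, Circle)} (hh : IsSemiconjugacy f d h)
    (hf : IsCoveringMap f) (hdeg : HasDegree f d) :
    ∃ (H : C(Strip, ℝ)) (F : Strip ≃ₜ Strip) (e : ℤ), (e = 1 ∨ e = -1) ∧
      (∀ p, turn (e * H p) = h (proj p)) ∧ (∀ p (n : ℤ), H (shift n p) = H p + n) ∧
      IsEquivariant F d ∧ (∀ p, proj (F p) = f (proj p)) ∧ ∀ p, H (F p) = d * H p := by
  obtain ⟨H, hH⟩ := exists_lift_circle h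
  obtain ⟨e, he, hs⟩ := hh.inducesIso.exists_unit hH
  obtain ⟨F, hF, hFf⟩ := hdeg.exists_lift hf
  have hee : (e : ℝ) * e = 1 := by rcases he with rfl | rfl <;> norm_num
  obtain ⟨k, hk⟩ := isPreconnected_univ.exists_int_forall_abs_sub_le
    (ψ := fun p => H (F p) - d * H p) (c := 0) (by fun_prop) (by norm_num) (fun p _ => by
      have : turn (H (F p)) = turn (d * H p) := by
        rw [hH, hFf, turn_zsmul, hH]
        exact hh.semiconj (proj p)
      obtain ⟨n, hn⟩ := turn_eq_turn.1 this
      exact ⟨n, by simp [hn]⟩)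
  have hk' : ∀ p, H (F p) - d * H p = k := fun p =>
    sub_eq_zero.1 (abs_nonpos_iff.1 (hk p trivial))
  refine ⟨⟨fun p => e * H p, by fun_prop⟩, F.trans (shift (-(e * k) : ℤ)), e, he, fun p => ?_,
    fun p n => ?_, hF.trans_shift _, fun p => ?_, fun p => ?_⟩
  · rw [ContinuousMap.coe_mk, ← mul_assoc, hee, one_mul, hH]
  · rw [ContinuousMap.coe_mk, hs]
    linear_combination (n : ℝ) * hee
  · rw [Homeomorph.trans_apply, proj_shift_int, hFf]
  · rw [ContinuousMap.coe_mk, Homeomorph.trans_apply, hs]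
    push_cast
    linear_combination (e : ℝ) * hk' p - (e : ℝ) * k * hee

theorem IsSemiconjugacy.exists_isConnector {h : C(OpenAnnulus, Circle)}
    (hh : IsSemiconjugacy f d h) (hf : IsCoveringMap f) (hdeg : HasDegree f d) (z : Circle) :
    ∃ C : Set OpenAnnulus, IsConnector C ∧ C ⊆ h ⁻¹' {z} := by
  obtain ⟨H, F, e, he, hH, hs, -⟩ := hh.exists_lift hf hdeg
  obtain ⟨t, rfl⟩ := turn_surjective z
  have hee : (e : ℝ) * e = 1 := by rcases he with rfl | rfl <;> norm_num
  obtain ⟨M, hM, hMc, -⟩ := exists_isCut_subset_level hs (e * t)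
  refine ⟨proj '' M, isConnector_image_proj hs hM hMc, ?_⟩
  rintro _ ⟨p, hp, rfl⟩
  rw [mem_preimage, mem_singleton_iff, ← hH, hMc p hp, ← mul_assoc, hee, one_mul]

theorem isTrivialConnector_image_proj {H : C(Strip, ℝ)}
    (hs : ∀ p (n : ℤ), H (shift n p) = H p + n) {M : Set Strip} {c : ℝ}
    (hM : IsCut M) (hMc : ∀ p ∈ M, H p = c) : IsTrivialConnector (proj '' M) := by
  obtain ⟨h, hh⟩ := exists_descend hs
  refine ⟨isConnector_image_proj hs hM hMc, not_isEssential_of_subset_fiber (z := turn c)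
    one_ne_zero hh (by simpa using hs) ?_⟩
  rintro _ ⟨p, hp, rfl⟩
  rw [mem_preimage, mem_singleton_iff, ← hh, hMc p hp]

theorem image_image_proj {F : Strip ≃ₜ Strip} (hF : ∀ p, proj (F p) = f (proj p)) (M : Set Strip) :
    f '' (proj '' M) = proj '' (F '' M) := by
  simp only [image_image, hF]

theorem IsSemiconjugacy.exists_invariant_of_pos {h : C(OpenAnnulus, Circle)}
    (hh : IsSemiconjugacy f d h) (hf : IsCoveringMap f) (hdeg : HasDegree f d) (hd : 0 < d) :
    ∃ C : Set OpenAnnulus, IsTrivialConnector C ∧ f '' C = C ∧ C ⊆ h ⁻¹' {1} := by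
  obtain ⟨H, F, e, he, hH, hs, hF, hFf, hHF⟩ := hh.exists_lift hf hdeg
  obtain ⟨M, hM, hMc, hFM⟩ := exists_isCut_subset_level hs 0
  refine ⟨proj '' M, isTrivialConnector_image_proj hs hM hMc, ?_, ?_⟩
  · rw [image_image_proj hFf, hFM rfl F d hd hF hHF]
  · rintro _ ⟨p, hp, rfl⟩
    rw [mem_preimage, mem_singleton_iff, ← hH, hMc p hp, mul_zero, turn_zero]

/-- If the sets above and below the level zero of a height function are connected, then a connected
part of this level is invariant under maps that reverse the height. -/
theorem exists_isCut_image_eq {H : C(Strip, ℝ)} (hs : ∀ p (n : ℤ), H (shift n p) = H p + n)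
    (hpos : IsPreconnected {p | 0 < H p}) (hneg : IsPreconnected {p | H p < 0})
    {F : Strip ≃ₜ Strip} (hd : d < 0) (hHF : ∀ p, H (F p) = d * H p) :
    ∃ M, IsCut M ∧ (∀ p ∈ M, H p = 0) ∧ F '' M = M := by
  have hd' : (d : ℝ) < 0 := by exact_mod_cast hd
  set W := {p | 0 < H p}
  set W' := {p | H p < 0}
  have hWo : IsOpen W := isOpen_lt continuous_const H.continuous
  have hWo' : IsOpen W' := isOpen_lt H.continuous continuous_const
  have hWW : Disjoint W W' := Set.disjoint_left.2 fun p (hp : 0 < H p) (hp' : H p < 0) =>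
    hp.not_gt hp'
  have far : ∀ x : Ioo (0 : ℝ) 1, (∃ t, (x, t) ∈ W) ∧ ∃ t, (x, t) ∈ W' := by
    intro x
    have h1 := hs (x, 0) (⌊-H (x, 0)⌋ + 1)
    have h2 := hs (x, 0) (⌈-H (x, 0)⌉ - 1)
    have g1 := Int.lt_floor_add_one (-H (x, 0))
    have g2 := Int.ceil_lt_add_one (-H (x, 0))
    push_cast at h1 h2
    exact ⟨⟨_, show 0 < H (shift (⌊-H (x, 0)⌋ + 1) (x, 0)) by linarith⟩,
      ⟨_, show H (shift (⌈-H (x, 0)⌉ - 1) (x, 0)) < 0 by linarith⟩⟩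
  obtain ⟨⟨t, hp⟩, ⟨t', hp'⟩⟩ := far ⟨1 / 2, by norm_num, by norm_num⟩
  set p : Strip := (⟨1 / 2, by norm_num, by norm_num⟩, t)
  set p' : Strip := (⟨1 / 2, by norm_num, by norm_num⟩, t')
  set Q := connectedComponentIn Wᶜ p' with hQ
  set Q' := connectedComponentIn W'ᶜ p with hQ'
  have hQc : IsClosed Q := hWo.isClosed_compl.isClosed_connectedComponentIn _
  have hQc' : IsClosed Q' := hWo'.isClosed_compl.isClosed_connectedComponentIn _
  have hsub : W' ⊆ Q := hneg.subset_connectedComponentIn hp' hWW.symm.subset_compl_right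
  have hsub' : W ⊆ Q' := hpos.subset_connectedComponentIn hp hWW.subset_compl_right
  -- This covering is the input for unicoherence; as `F` exchanges `Q` and `Q'`, it preserves their
  -- intersection.
  have huniv : Q ∪ Q' = univ :=
    connectedComponentIn_compl_union_eq_univ hpos hWo hneg hWW hp hp'
  have hlev : ∀ z ∈ Q ∩ Q', H z = 0 := fun z hz => le_antisymm
    (not_lt.1 (connectedComponentIn_subset _ _ hz.1))
    (not_lt.1 (connectedComponentIn_subset _ _ hz.2))
  refine ⟨Q ∩ Q', isCut_of_subset_level hs (hQc.inter hQc')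
    (isPreconnected_inter_connectedComponentIn_compl hpos hWo hneg hWo' hWW hp hp') (fun x => ?_)
    hlev, hlev, ?_⟩
  · obtain ⟨⟨t₁, h₁⟩, ⟨t₂, h₂⟩⟩ := far x
    have hl : Continuous fun t : ℝ => ((x, t) : Strip) := by fun_prop
    obtain ⟨t, -, ht⟩ := isPreconnected_closed_iff.1 isPreconnected_univ _ _
      (hQc.preimage hl) (hQc'.preimage hl)
      (fun t _ => (huniv ▸ mem_univ (x, t) : (x, t) ∈ Q ∪ Q'))
      ⟨t₂, trivial, hsub h₂⟩ ⟨t₁, trivial, hsub' h₁⟩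
    exact ⟨t, ht⟩
  · have hF1 : F '' W = W' := by
      ext z
      rw [F.image_eq_preimage_symm, mem_preimage]
      have := hHF (F.symm z)
      rw [F.apply_symm_apply] at this
      change 0 < H (F.symm z) ↔ H z < 0
      rw [this]
      constructor <;> intro h <;> nlinarith
    have hF2 : F '' W' = W := by
      ext z
      rw [F.image_eq_preimage_symm, mem_preimage]
      have := hHF (F.symm z)
      rw [F.apply_symm_apply] at this
      change H (F.symm z) < 0 ↔ 0 < H z
      rw [this]
      constructor <;> intro h <;> nlinarith
    have e1 : F '' Q = Q' := by
      rw [hQ, F.image_connectedComponentIn (hWW.symm.subset_compl_right hp'), F.image_compl, hF1]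
      exact (connectedComponentIn_eq (hsub' (hF2 ▸ mem_image_of_mem F hp'))).symm
    have e2 : F '' Q' = Q := by
      rw [hQ', F.image_connectedComponentIn (hWW.subset_compl_right hp), F.image_compl, hF2]
      exact (connectedComponentIn_eq (hsub (hF1 ▸ mem_image_of_mem F hp))).symm
    rw [image_inter F.injective, e1, e2, inter_comm]

/-- The height of `h` itself need not have connected sets above and below zero. A cut in its zero
level yields, through `IsCut.exists_expanding`, another height `K` that does. -/
theorem IsSemiconjugacy.exists_invariant_of_neg {h : C(OpenAnnulus, Circle)}
    (hh : IsSemiconjugacy f d h) (hf : IsCoveringMap f) (hdeg : HasDegree f d) (hd : d < -1) :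
    ∃ C : Set OpenAnnulus, IsTrivialConnector C ∧ f '' C = C := by
  obtain ⟨H, F, e, he, hH, hs, hF, hFf, hHF⟩ := hh.exists_lift hf hdeg
  obtain ⟨M, hM, hMc, -⟩ := exists_isCut_subset_level hs 0
  obtain ⟨K, hK, hKs, hpos, hneg⟩ := hM.exists_expanding hF
    (by rw [abs_of_neg (by omega)]; omega) (fun p hp n hn => by
      have := hMc _ hn
      rw [hs, hHF, hMc p hp, mul_zero, zero_add] at this
      exact_mod_cast this)
  obtain ⟨N, hN, hNc, hFN⟩ := exists_isCut_image_eq hKs hpos hneg (by omega : d < 0) hK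
  exact ⟨proj '' N, isTrivialConnector_image_proj hKs hN hNc, by rw [image_image_proj hFf, hFN]⟩

end Semiconjugacy

/-! ### From trivial connectors to semiconjugacies -/

theorem JoinedIn.shift_int {R : Set OpenAnnulus} {p q : Strip} (h : JoinedIn (proj ⁻¹' R) p q)
    (m : ℤ) : JoinedIn (proj ⁻¹' R) (shift m p) (shift m q) := by
  obtain ⟨γ, hγ⟩ := h
  refine ⟨γ.map (shift m).continuous, fun t => ?_⟩
  rw [mem_preimage, Path.map_coe, Function.comp_apply, proj_shift_int]
  exact hγ t

/-- A set that contains a loop of nonzero class contains a loop of class one. -/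
theorem AnnulusLoopClass.exists_one {U : Set OpenAnnulus} {a : OpenAnnulus} {γ : Path a a} {n : ℤ}
    (hγ : AnnulusLoopClass γ n) (hn : n ≠ 0) (hU : ∀ t, γ t ∈ U) :
    ∃ (b : OpenAnnulus) (δ : Path b b), (∀ t, δ t ∈ U) ∧ AnnulusLoopClass δ 1 := by
  obtain ⟨p, hp⟩ := proj_surjective a
  obtain ⟨Γ, hΓ⟩ := hγ.exists_lift hp
  have : PathConnectedSpace unitInterval := isPathConnected_iff_pathConnectedSpace.1
    ((convex_Icc (0 : ℝ) 1).isPathConnected (nonempty_Icc.2 zero_le_one))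
  have hrange : ∀ {x y : Strip} (δ : Path x y) (s t : unitInterval),
      JoinedIn (range δ) (δ s) (δ t) := fun δ s t =>
    (isPathConnected_range δ.continuous).joinedIn _ (mem_range_self s) _ (mem_range_self t)
  set S := proj ⁻¹' range γ with hS
  have hΓS : range Γ ⊆ S := by
    rintro _ ⟨t, rfl⟩
    exact ⟨t, (hΓ t).symm⟩
  have hstep : JoinedIn S p (shift n p) := ⟨Γ, fun t => hΓS (mem_range_self t)⟩
  have hfar : ∀ j : ℤ, JoinedIn S p (shift (n * j : ℤ) p) := by
    intro j
    induction j using Int.induction_on with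
    | zero =>
      rw [mul_zero, Int.cast_zero, shift_zero]
      exact JoinedIn.refl hstep.source_mem
    | succ j ih =>
      have := ih.trans (hstep.shift_int (n * j))
      rw [shift_shift] at this
      convert this using 2
      push_cast; ring_nf
    | pred j ih =>
      have := hstep.shift_int (n * (-j - 1))
      rw [shift_shift] at this
      refine ih.trans (JoinedIn.symm ?_)
      convert this using 2
      push_cast; ring_nf
  have hK : IsCompact (range Γ) := isCompact_range Γ.continuous
  obtain ⟨_, ⟨s₁, rfl⟩, hmin⟩ := hK.exists_isMinOn ⟨_, mem_range_self 0⟩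
    (f := fun z : Strip => (z.1 : ℝ)) (by fun_prop)
  obtain ⟨_, ⟨s₂, rfl⟩, hmax⟩ := hK.exists_isMaxOn ⟨_, mem_range_self 0⟩
    (f := fun z : Strip => (z.1 : ℝ)) (by fun_prop)
  -- A piece of `Γ` between its extreme abscissae, moved up by 1, must cross a long path `δ` over
  -- the same loop. The crossing joins a point of `Γ` to its translate by 1 inside `S`.
  obtain ⟨η₀, hη₀⟩ := hrange Γ s₁ s₂
  let η := η₀.map (shift (1 : ℤ)).continuous
  obtain ⟨B, hB⟩ := ((isCompact_range η.continuous).image continuous_snd).isBounded.exists_norm_le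
  have hB' : ∀ s, |(η s).2| ≤ B := fun s => hB _ ⟨_, ⟨s, rfl⟩, rfl⟩
  obtain ⟨k, hk⟩ := exists_nat_gt (B + |p.2|)
  -- The translation number is `n * (n * k)` so that it is positive for either sign of `n`.
  have hnk : (k : ℝ) ≤ n * (n * k) := by
    have h1 : (1 : ℝ) ≤ (n * n : ℤ) := by
      exact_mod_cast (mul_self_pos.2 hn : 0 < n * n)
    push_cast at h1
    nlinarith [(Nat.cast_nonneg k : (0 : ℝ) ≤ k)]
  obtain ⟨δ, hδ⟩ := (hfar (n * k)).symm.trans (hfar (-(n * k)))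
  have hδx : ∀ s, ((Γ s₁).1 : ℝ) ≤ (δ s).1 ∧ ((δ s).1 : ℝ) ≤ (Γ s₂).1 := by
    intro s
    obtain ⟨u, hu⟩ := hδ s
    rw [← hΓ] at hu
    have hu1 : (Γ u).1 = (δ s).1 := congrArg (fun a : OpenAnnulus => a.1) hu
    rw [← hu1]
    exact ⟨hmin (mem_range_self u), hmax (mem_range_self u)⟩
  obtain ⟨s, t, hst, hst'⟩ := exists_path_crossing (x := fun z : Strip => (z.1 : ℝ))
    (y := fun z : Strip => z.2) (by fun_prop) (by fun_prop) η δ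
    (fun s => (hδx s).1) (fun s => (hδx s).2)
    (fun s => by
      have := (abs_le.1 (hB' s)).2
      have := neg_abs_le p.2
      simp only [shift_snd]; push_cast; linarith)
    (fun s => by
      have := (abs_le.1 (hB' s)).1
      have := le_abs_self p.2
      simp only [shift_snd]; push_cast; linarith)
  have hEq : η s = δ t := Prod.ext (Subtype.ext hst) hst'
  obtain ⟨u, hu⟩ := hη₀ s
  have hηs : η s = shift (1 : ℤ) (Γ u) := by rw [hu]; rfl
  have j1 : JoinedIn S (Γ u) p := by
    have := (hrange Γ u 0).mono hΓS
    rwa [Γ.source] at this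
  have j2 : JoinedIn S p (δ t) := by
    have := (hrange δ 0 t).mono (range_subset_iff.2 hδ)
    rw [δ.source] at this
    exact (hfar _).trans this
  rw [← hEq, hηs] at j2
  obtain ⟨Λ, hΛ⟩ := j1.trans j2
  refine ⟨_, projLoop Λ, fun t => ?_, annulusLoopClass_projLoop Λ⟩
  obtain ⟨v, hv⟩ := hΛ t
  change proj (Λ t) ∈ U
  rw [← hv]
  exact hU v

theorem eq_zero_of_not_isEssentialOpen {U : Set OpenAnnulus} (hU : ¬ IsEssentialOpen U)
    {a : OpenAnnulus} {γ : Path a a} {n : ℤ} (hγ : AnnulusLoopClass γ n) (h : ∀ t, γ t ∈ U) :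
    n = 0 := by
  by_contra hn
  obtain ⟨b, δ, hδ, h1⟩ := hγ.exists_one hn h
  refine hU ((AddSubgroup.eq_top_iff' _).2 fun m => ?_)
  have hmem : (1 : ℤ) ∈ {n : ℤ | ∃ (a : OpenAnnulus) (γ : Path a a),
      (∀ t, γ t ∈ U) ∧ AnnulusLoopClass γ n} := ⟨b, δ, hδ, h1⟩
  have := AddSubgroup.zsmul_mem _ (AddSubgroup.subset_closure hmem) m
  rwa [smul_eq_mul, mul_one] at this

/-- A trivial connector lifts to a cut of the strip. -/
theorem IsTrivialConnector.exists_isCut {C : Set OpenAnnulus} (hC : IsTrivialConnector C) :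
    ∃ M, IsCut M ∧ M ⊆ proj ⁻¹' C ∧ (∀ q, proj q ∈ C → ∃ n : ℤ, shift n q ∈ M) ∧
      ∀ S, IsPreconnected S → S ⊆ proj ⁻¹' C → (S ∩ M).Nonempty → S ⊆ M := by
  obtain ⟨U, hUo, hCU, hU⟩ : ∃ U, IsOpen U ∧ C ⊆ U ∧ ¬ IsEssentialOpen U := by
    have := hC.not_essential
    rw [IsEssential] at this
    push Not at this
    exact this
  obtain ⟨c, hc⟩ := hC.isConnector.isConnected.nonempty
  obtain ⟨p, rfl⟩ := proj_surjective c
  have hUo' : IsOpen (proj ⁻¹' U) := hUo.preimage proj.continuous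
  set V := connectedComponentIn (proj ⁻¹' U) p with hV
  have hpV : p ∈ V := mem_connectedComponentIn (hCU hc)
  have hVo : IsOpen V := hUo'.connectedComponentIn
  have hVU : V ⊆ proj ⁻¹' U := connectedComponentIn_subset _ _
  have hVp : IsPathConnected V := hVo.isConnected_iff_isPathConnected.1
    (isConnected_connectedComponentIn_iff.2 (hCU hc))
  have hVs : ∀ q ∈ V, ∀ n : ℤ, shift n q ∈ V → n = 0 := by
    intro q hq n hn
    obtain ⟨Γ, hΓ⟩ := hVp.joinedIn q hq _ hn
    exact eq_zero_of_not_isEssentialOpen hU (annulusLoopClass_projLoop Γ) fun t => hVU (hΓ t)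
  have hVn : ∀ n : ℤ, IsOpen {q | shift n q ∈ V} := fun n => hVo.preimage (shift n).continuous
  -- The points over `U` with no translate in `V` form an open set whose image is disjoint from that
  -- of `V`; the connected set `C` cannot meet both.
  have hCV : C ⊆ proj '' V := by
    have hopen : IsOpen {q | proj q ∈ U ∧ ∀ n : ℤ, shift n q ∉ V} := by
      refine isOpen_iff_mem_nhds.2 fun q hq => Filter.mem_of_superset
        (hUo'.connectedComponentIn.mem_nhds (mem_connectedComponentIn hq.1)) fun z hz => ?_
      refine ⟨connectedComponentIn_subset (proj ⁻¹' U) q hz, fun n hn => hq.2 n ?_⟩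
      rw [hV, connectedComponentIn_eq hn]
      refine (isPreconnected_connectedComponentIn.image (shift n)
        (shift n).continuous.continuousOn).subset_connectedComponentIn ⟨z, hz, rfl⟩ ?_
        ⟨q, mem_connectedComponentIn hq.1, rfl⟩
      rintro _ ⟨y, hy, rfl⟩
      rw [mem_preimage, proj_shift_int]
      exact connectedComponentIn_subset (proj ⁻¹' U) q hy
    refine IsPreconnected.subset_left_of_subset_union (isOpenMap_proj _ hVo)
      (isOpenMap_proj _ hopen) ?_ (fun a ha => ?_) ⟨_, hc, p, hpV, rfl⟩
      hC.isConnector.isConnected.isPreconnected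
    · rw [Set.disjoint_left]
      rintro _ ⟨q, hq, rfl⟩ ⟨r, hr, hrq⟩
      obtain ⟨n, rfl⟩ := proj_eq_proj.1 hrq.symm
      exact hr.2 n hq
    · obtain ⟨q, rfl⟩ := proj_surjective a
      by_cases h : ∃ n : ℤ, shift n q ∈ V
      · obtain ⟨n, hn⟩ := h
        exact Or.inl ⟨_, hn, proj_shift_int n q⟩
      · exact Or.inr ⟨q, ⟨hCU ha, not_exists.1 h⟩, rfl⟩
  have hex : ∀ q, proj q ∈ C → ∃ n : ℤ, shift n q ∈ V := by
    intro q hq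
    obtain ⟨r, hr, hrq⟩ := hCV hq
    obtain ⟨n, rfl⟩ := proj_eq_proj.1 hrq
    exact ⟨n, hr⟩
  have hCc : IsClosed (proj ⁻¹' C) := hC.isConnector.isClosed.preimage proj.continuous
  -- Over `C`, lying in `V` means lying in no other translate of `V`, which is a closed condition.
  have hMeq : proj ⁻¹' C ∩ V = proj ⁻¹' C ∩ ⋂ n : {n : ℤ // n ≠ 0}, {q | shift n.1 q ∈ V}ᶜ := by
    ext q
    refine and_congr_right fun hq => ?_
    rw [mem_iInter]
    constructor
    · exact fun hqV n hn => n.2 (hVs q hqV n hn)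
    · intro h
      obtain ⟨n, hn⟩ := hex q hq
      by_cases hn0 : n = 0
      · simpa [hn0] using hn
      · exact absurd hn (h ⟨n, hn0⟩)
  refine ⟨proj ⁻¹' C ∩ V, ⟨?_, ?_, ?_, ?_, ?_⟩, inter_subset_left, ?_, ?_⟩
  · rw [hMeq]
    exact hCc.inter (isClosed_iInter fun n => (hVn n).isClosed_compl)
  · have hinj : Function.Injective fun q : V => proj q := by
      intro q r hqr
      obtain ⟨n, hn⟩ := proj_eq_proj.1 hqr
      have := hVs r r.2 n (hn ▸ q.2)
      exact Subtype.ext (by rw [hn, this]; simp)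
    have := hC.isConnector.isConnected.isPreconnected.preimage_of_isOpenMap hinj
      (isOpenMap_proj.comp hVo.isOpenMap_subtype_val) (fun a ha => by
        obtain ⟨q, hq, rfl⟩ := hCV ha
        exact ⟨⟨q, hq⟩, rfl⟩)
    have h2 := this.image Subtype.val continuous_subtype_val.continuousOn
    convert h2 using 1
    ext q
    constructor
    · rintro ⟨h, h'⟩
      exact ⟨⟨q, h'⟩, h, rfl⟩
    · rintro ⟨⟨r, h'⟩, h, rfl⟩
      exact ⟨h, h'⟩
  · intro x
    obtain ⟨⟨a, ha, hax⟩, -⟩ := hC.isConnector.accumulates x x.2.1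
    obtain ⟨-, b, hb, hbx⟩ := hC.isConnector.accumulates (1 - x) (sub_pos.2 x.2.2)
    obtain ⟨y, hy, hyx⟩ := hC.isConnector.isConnected.isPreconnected.intermediate_value ha hb
      (f := fun a : OpenAnnulus => (a.1 : ℝ)) (by fun_prop)
      (⟨hax.le, by linarith⟩ : (x : ℝ) ∈ Icc (a.1 : ℝ) b.1)
    obtain ⟨q, hq, rfl⟩ := hCV hy
    have hqx : q.1 = x := Subtype.ext hyx
    exact ⟨q.2, by rw [← hqx]; exact ⟨hy, hq⟩⟩
  · intro a b
    have hK : IsCompact ((Icc a b ×ˢ Icc (0 : ℝ) 1) ∩ proj ⁻¹' C) :=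
      ((isCompact_Icc_unit a b).prod isCompact_Icc).inter_right hCc
    -- Finitely many translates of `V` cover the part of the preimage of `C` in a fundamental box;
    -- their indices bound the height of `M`.
    obtain ⟨t, ht⟩ := hK.elim_finite_subcover _ hVn fun q hq => mem_iUnion.2 (hex q hq.2)
    refine ⟨∑ n ∈ t, |(n : ℝ)| + 1, fun q hq h1 h2 => ?_⟩
    have g1 := Int.floor_le q.2
    have g2 := Int.lt_floor_add_one q.2
    have hmem := ht (⟨⟨⟨h1, h2⟩, by
      rw [shift_snd]; push_cast
      constructor <;> linarith⟩, by
      rw [mem_preimage, proj_shift_int]; exact hq.1⟩ :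
        shift (-⌊q.2⌋ : ℤ) q ∈ (Icc a b ×ˢ Icc (0 : ℝ) 1) ∩ proj ⁻¹' C)
    obtain ⟨n, hnt, hn⟩ := mem_iUnion₂.1 hmem
    rw [mem_ofPred_eq, shift_shift, ← Int.cast_add] at hn
    have h0 := hVs q hq.2 _ hn
    have hnf : (⌊q.2⌋ : ℝ) = n := by exact_mod_cast (by omega : ⌊q.2⌋ = n)
    have hle := Finset.single_le_sum (f := fun n : ℤ => |(n : ℝ)|) (fun _ _ => abs_nonneg _) hnt
    have := le_abs_self (n : ℝ)
    have := neg_abs_le (n : ℝ)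
    rw [hnf] at g1 g2
    rw [abs_le]
    constructor <;> linarith
  · exact fun q hq n hn => hVs q hq.2 n hn.2
  · intro q hq
    obtain ⟨n, hn⟩ := hex q hq
    exact ⟨n, by rw [mem_preimage, proj_shift_int]; exact hq, hn⟩
  · rintro S hS hSC ⟨q, hqS, -, hqV⟩
    refine subset_inter hSC (IsPreconnected.subset_left_of_subset_union hVo
      (isOpen_iUnion fun n : {n : ℤ // n ≠ 0} => hVn n.1) ?_ (fun r hr => ?_) ⟨q, hqS, hqV⟩ hS)
    · rw [Set.disjoint_left]
      intro r hr hr'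
      obtain ⟨n, hn⟩ := mem_iUnion.1 hr'
      exact n.2 (hVs r hr n hn)
    · obtain ⟨n, hn⟩ := hex r (hSC hr)
      by_cases hn0 : n = 0
      · left; simpa [hn0] using hn
      · exact Or.inr (mem_iUnion.2 ⟨⟨n, hn0⟩, hn⟩)

theorem IsTrivialConnector.exists_isSemiconjugacy {f : C(OpenAnnulus, OpenAnnulus)} {d : ℤ}
    (hd : 1 < |d|) (hf : IsCoveringMap f) (hdeg : HasDegree f d) {C : Set OpenAnnulus}
    (hC : IsTrivialConnector C) (hfC : f '' C ⊆ C) :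
    ∃ h : C(OpenAnnulus, Circle), IsSemiconjugacy f d h := by
  obtain ⟨M, hM, hMC, hex, hmax⟩ := hC.exists_isCut
  obtain ⟨F, hF, hFf⟩ := hdeg.exists_lift hf
  have hFC : ∀ q ∈ M, proj (F q) ∈ C := fun q hq => by
    rw [hFf]; exact hfC ⟨_, hMC hq, rfl⟩
  obtain ⟨p, hp⟩ := hM.nonempty
  obtain ⟨k, hk⟩ := hex _ (hFC p hp)
  set G := F.trans (shift k) with hG
  -- The deck translation by `k` brings one image point back to `M`; maximality of `M` among
  -- connected sets over `C` does the rest.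
  have hGM : G '' M ⊆ M := by
    refine hmax _ (hM.isPreconnected.image _ G.continuous.continuousOn) ?_ ⟨_, ⟨p, hp, rfl⟩, hk⟩
    rintro _ ⟨q, hq, rfl⟩
    rw [mem_preimage, hG, Homeomorph.trans_apply, proj_shift_int]
    exact hFC q hq
  obtain ⟨H, hH, hs, -⟩ := hM.exists_expanding (hF.trans_shift k) hd fun q hq n hn =>
    hM.eq_zero_of_shift_mem _ (hGM ⟨q, hq, rfl⟩) n hn
  obtain ⟨h, hh⟩ := exists_descend hs
  refine ⟨h, fun a => ?_, inducesIso_of_lift hh hs⟩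
  obtain ⟨q, rfl⟩ := proj_surjective a
  have := hH q
  change h (f (proj q)) = h (proj q) ^ d
  rw [← hFf, ← proj_shift_int k, ← hh, ← hh, ← turn_zsmul, ← this]
  rfl

theorem corollary3p3 (d : ℤ) (hd : 1 < |d|) (f : C(OpenAnnulus, OpenAnnulus))
    (hf : IsCoveringMap f) (hdeg : HasDegree f d) :
    (∀ h : C(OpenAnnulus, Circle), IsSemiconjugacy f d h →
      (∀ z : Circle, ∃ C : Set OpenAnnulus, IsConnector C ∧ C ⊆ h ⁻¹' {z}) ∧
      (1 < d → ∃ C : Set OpenAnnulus, IsTrivialConnector C ∧ f '' C = C ∧ C ⊆ h ⁻¹' {1})) ∧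
    ((∃ h : C(OpenAnnulus, Circle), IsSemiconjugacy f d h) ↔
      ∃ C : Set OpenAnnulus, IsTrivialConnector C ∧ f '' C = C) := by
  refine ⟨fun h hh => ⟨hh.exists_isConnector hf hdeg, fun h1 =>
    hh.exists_invariant_of_pos hf hdeg (one_pos.trans h1)⟩, ?_, ?_⟩
  · rintro ⟨h, hh⟩
    rcases lt_abs.1 hd with h1 | h1
    · obtain ⟨C, hC, hfC, -⟩ := hh.exists_invariant_of_pos hf hdeg (one_pos.trans h1)
      exact ⟨C, hC, hfC⟩
    · exact hh.exists_invariant_of_neg hf hdeg (by omega)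
  · rintro ⟨C, hC, hfC⟩
    exact hC.exists_isSemiconjugacy hd hf hdeg hfC.le
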